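/- Let $M$ be a smooth manifold (Hausdorff, second countable) with a Poisson structure (for instance a symplectic one), let $*$ be a star product $f*g=\sum_r\lambda^rC_r(f,g)$ on $C^\infty(M)[[\lambda]]$ (complex-valued functions; $C_r$ bidifferential, $C_0(f,g)=fg$, $C_1(f,g)-C_1(g,f)=\mathrm i\{f,g\}$, $C_r(1,\cdot)=C_r(\cdot,1)=0$ for $r\ge 1$). Let $\mathfrak g$ be a finite-dimensional real Lie algebra with basis $e_1,\dots,e_n$, dual basis $e^1,\dots,e^n$ and structure constants $f^c_{ab}=\langle e^c,[e_a,e_b]\rangle$, and let $\mathbf J=\sum_r\lambda^r\mathbf J_r$, with $\mathbf J_r:M\to\mathfrak g^*$ smooth, satisfy $\langle\mathbf J,\xi\rangle*\langle\mathbf J,\eta\rangle-\langle\mathbf J,\eta\rangle*\langle\mathbf J,\xi\rangle=\mathrm i\lambda\langle\mathbf J,[\xi,\eta]\rangle$ for all $\xi,\eta\in\mathfrak g$. Put $J=\mathbf J_0$, assume that $0$ is a regular value of $J$, and let $\iota:C=J^{-1}(0)\to M$ be the inclusion. Let $\mathcal A_i=\bigwedge\mathfrak g^*\otimes\bigwedge^i\mathfrak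 g\otimes C^\infty(M)$. For $\alpha\in\bigwedge^k\mathfrak g^*$, $x\in\bigwedge^{i}\mathfrak g$ and $F$ a function (or a formal series of functions), define $$\partial_i(\alpha\otimes x\otimes F)=(-1)^k\sum_a\alpha\otimes i(e^a)x\otimes F J_a,$$ $$\boldsymbol\partial_i(\alpha\otimes x\otimes F)=(-1)^k\,\alpha\otimes\Big(\sum_a i(e^a)x\otimes F*\mathbf J_a+\mathrm i\lambda\big(\tfrac12u-q\big)x\otimes F\Big),$$ where $J_a=\langle J,e_a\rangle$, $\mathbf J_a=\langle\mathbf J,e_a\rangle$, $q=-\frac12\sum_{a,b,c}f^c_{ab}\,e_c\wedge i(e^a)i(e^b)$ and $u=\sum_{a,b}f^b_{ab}\,i(e^a)$; both are extended $\mathbb C[[\lambda]]$-linearly to $\partial_i,\boldsymbol\partial_i:\mathcal A_i[[\lambda]]\to\mathcal A_{i-1}[[\lambda]]$, $i\ge1$. They agree in order $\lambda^0$; put $B_1=\frac1\lambda(\partial_1-\boldsymbol\partial_1)$. A classical chain homotopy consists of $\mathbb C$-linear maps $\mathrm{prol}:C^\infty(C)\to C^\infty(M)$ and $h_i:\bigwedge^i\mathfrak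 g\otimes C^\infty(M)\to\bigwedge^{i+1}\mathfrak g\otimes C^\infty(M)$ ($i\ge0$) such that, with $\partial_i$ restricted to $\bigwedge^i\mathfrak g\otimes C^\infty(M)$, one has $\iota^*\mathrm{prol}=\mathrm{id}$, $\mathrm{prol}\,\iota^*+\partial_1h_0=\mathrm{id}$, $h_{i-1}\partial_i+\partial_{i+1}h_i=\mathrm{id}$ for $i\ge1$, and $h_0\,\mathrm{prol}=0$. The maps $\iota^*,\mathrm{prol},h_i$ are extended to $\bigwedge\mathfrak g^*\otimes(\cdot)$ by $T(\alpha\otimes v)=(-1)^k\alpha\otimes Tv$ for $\alpha\in\bigwedge^k\mathfrak g^*$, and $\mathbb C[[\lambda]]$-linearly to formal series. Then classical chain homotopies exist, and for every classical chain homotopy the following holds. 1. $\mathrm{id}-\lambda B_1h_0$ is invertible on $\mathcal A_0[[\lambda]]$. Put $\boldsymbol\iota^*=\iota^*(\mathrm{id}-\lambda B_1h_0)^{-1}$. 2. $\mathrm{prol}\,\boldsymbol\iota^*+\boldsymbol\partial_1h_0$ is invertible on $\mathcal A_0[[\lambda]]$, and $h_{i-1}\boldsymbol\partial_i+\boldsymbol\partial_{i+1}h_i$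 is invertible on $\mathcal A_i[[\lambda]]$ for every $i\ge1$. Put $$\mathbf h_0=h_0(\mathrm{prol}\,\boldsymbol\iota^*+\boldsymbol\partial_1h_0)^{-1},\qquad \mathbf h_i=h_i(h_{i-1}\boldsymbol\partial_i+\boldsymbol\partial_{i+1}h_i)^{-1}\quad(i\ge1).$$ Then also $\mathbf h_0=h_0(\mathrm{id}-\lambda B_1h_0)^{-1}$. 3. On the augmented quantum complex $\hat{\mathcal A}[[\lambda]]=(\bigwedge\mathfrak g^*\otimes C^\infty(C))[[\lambda]]\oplus\bigoplus_{i\ge0}\mathcal A_i[[\lambda]]$ let $\hat{\boldsymbol\partial}$ be $\boldsymbol\partial_i$ on $\mathcal A_i[[\lambda]]$ for $i\ge1$, $\boldsymbol\iota^*$ on $\mathcal A_0[[\lambda]]$, and $0$ on $(\bigwedge\mathfrak g^*\otimes C^\infty(C))[[\lambda]]$; let $\hat{\mathbf h}$ be $\mathrm{prol}$ on $(\bigwedge\mathfrak g^*\otimes C^\infty(C))[[\lambda]]$ and $\mathbf h_i$ on $\mathcal A_i[[\lambda]]$ for $i\ge0$. Then $$\hat{\boldsymbol\partial}\,\hat{\mathbf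 h}+\hat{\mathbf h}\,\hat{\boldsymbol\partial}=\mathrm{id}.$$ 4. $\ker\hat{\boldsymbol\partial}=\operatorname{im}\hat{\boldsymbol\partial}$: the quantised augmented Koszul complex is a complex and is acyclic. -/

import Mathlib

open scoped Manifold ContDiff TensorProduct PowerSeries Topology

noncomputable section

namespace QuantumKoszul

/-! ### Formal power series with coefficients in a complex vector space -/

/-- `Formal V` is the space `V[[lam]]` of formal power series `∑ lam ^ r * v r` with `v r ∈ V`. -/
@[ext]
structure Formal (V : Type*) where
  coeff : ℕ → V

namespace Formal

/-- A formal series is the sequence of its coefficients. -/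
def equivFun (V : Type*) : Formal V ≃ (ℕ → V) := ⟨coeff, mk, fun _ => rfl, fun _ => rfl⟩

instance {V : Type*} [AddCommGroup V] : AddCommGroup (Formal V) := (equivFun V).addCommGroup

section

variable {V : Type*} [AddCommGroup V]

@[simp] theorem coeff_add (v w : Formal V) (n : ℕ) : (v + w).coeff n = v.coeff n + w.coeff n := rfl

@[simp] theorem coeff_sub (v w : Formal V) (n : ℕ) : (v - w).coeff n = v.coeff n - w.coeff n := rfl

@[simp] theorem coeff_zero (n : ℕ) : (0 : Formal V).coeff n = 0 := rfl

end

theorem sum_antidiagonal_assoc {N : Type*} [AddCommMonoid N] (n : ℕ) (F : ℕ → ℕ → ℕ → N) :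
    ∑ ij ∈ Finset.HasAntidiagonal.antidiagonal n,
        ∑ kl ∈ Finset.HasAntidiagonal.antidiagonal ij.1, F kl.1 kl.2 ij.2
      = ∑ ij ∈ Finset.HasAntidiagonal.antidiagonal n,
        ∑ kl ∈ Finset.HasAntidiagonal.antidiagonal ij.2, F ij.1 kl.1 kl.2 := by
  rw [Finset.sum_sigma', Finset.sum_sigma']
  refine Finset.sum_bij' (fun x _ => ⟨(x.2.1, x.2.2 + x.1.2), (x.2.2, x.1.2)⟩)
    (fun x _ => ⟨(x.1.1 + x.2.1, x.2.2), (x.1.1, x.2.1)⟩) ?_ ?_ ?_ ?_ ?_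
  · rintro ⟨⟨a, b⟩, ⟨c, d⟩⟩ h
    simp only [Finset.mem_sigma, Finset.HasAntidiagonal.mem_antidiagonal] at h ⊢
    grind
  · rintro ⟨⟨a, b⟩, ⟨c, d⟩⟩ h
    simp only [Finset.mem_sigma, Finset.HasAntidiagonal.mem_antidiagonal] at h ⊢
    grind
  · rintro ⟨⟨a, b⟩, ⟨c, d⟩⟩ h
    simp only [Finset.mem_sigma, Finset.HasAntidiagonal.mem_antidiagonal] at h
    obtain ⟨-, rfl⟩ := h
    rfl
  · rintro ⟨⟨a, b⟩, ⟨c, d⟩⟩ h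
    simp only [Finset.mem_sigma, Finset.HasAntidiagonal.mem_antidiagonal] at h
    obtain ⟨-, rfl⟩ := h
    rfl
  · rintro ⟨⟨a, b⟩, ⟨c, d⟩⟩ h
    rfl

theorem sum_antidiagonal_flip {N : Type*} [AddCommMonoid N] (n : ℕ) (F : ℕ → ℕ → N) :
    ∑ ij ∈ Finset.HasAntidiagonal.antidiagonal n, F ij.1 ij.2
      = ∑ ij ∈ Finset.HasAntidiagonal.antidiagonal n, F ij.2 ij.1 :=
  Finset.sum_bij' (fun x _ => x.swap) (fun x _ => x.swap)
    (fun x h => by simpa [add_comm] using h) (fun x h => by simpa [add_comm] using h)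
    (fun _ _ => rfl) (fun _ _ => rfl) (fun _ _ => rfl)

variable {V W : Type*} [AddCommGroup V] [Module ℂ V] [AddCommGroup W] [Module ℂ W]

/-- Multiplication of a vector-valued series by a scalar series (Cauchy product). -/
instance : SMul ℂ⟦X⟧ (Formal V) :=
  ⟨fun p v => ⟨fun n => ∑ ij ∈ Finset.HasAntidiagonal.antidiagonal n,
    PowerSeries.coeff ij.1 p • v.coeff ij.2⟩⟩

theorem coeff_smul (p : ℂ⟦X⟧) (v : Formal V) (n : ℕ) :
    (p • v).coeff n = ∑ ij ∈ Finset.HasAntidiagonal.antidiagonal n,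
      PowerSeries.coeff ij.1 p • v.coeff ij.2 := rfl

instance : Module ℂ⟦X⟧ (Formal V) where
  one_smul v := by
    ext n
    rw [coeff_smul, Finset.sum_eq_single (0, n)]
    · simp
    · rintro ⟨a, b⟩ h hne
      have ha : a ≠ 0 := by
        rintro rfl
        simp only [Finset.HasAntidiagonal.mem_antidiagonal, zero_add] at h
        exact hne (by rw [h])
      simp [PowerSeries.coeff_one, ha]
    · simp
  mul_smul p q v := by
    ext n
    simp only [coeff_smul, PowerSeries.coeff_mul, Finset.sum_smul, Finset.smul_sum, mul_smul]
    exact sum_antidiagonal_assoc n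
      (fun a b c => PowerSeries.coeff a p • PowerSeries.coeff b q • v.coeff c)
  smul_zero p := by ext n; simp [coeff_smul]
  smul_add p v w := by
    ext n
    simp [coeff_smul, Finset.sum_add_distrib]
  add_smul p q v := by
    ext n
    simp [coeff_smul, add_smul, Finset.sum_add_distrib]
  zero_smul v := by ext n; simp [coeff_smul]

/-- The `ℂ[[lam]]`-linear map `V[[lam]] → W[[lam]]` given by the formal series
`∑ lam ^ r * T r` of linear maps `T r : V → W`. -/
def opSeries (T : ℕ → V →ₗ[ℂ] W) : Formal V →ₗ[ℂ⟦X⟧] Formal W where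
  toFun v := ⟨fun n => ∑ rs ∈ Finset.HasAntidiagonal.antidiagonal n, T rs.1 (v.coeff rs.2)⟩
  map_add' v w := by
    ext n
    simp [Finset.sum_add_distrib]
  map_smul' p v := by
    ext n
    simp only [coeff_smul, map_sum, map_smul, Finset.smul_sum, RingHom.id_apply]
    rw [← sum_antidiagonal_assoc n (fun a b c => PowerSeries.coeff b p • T a (v.coeff c)),
      ← sum_antidiagonal_assoc n (fun a b c => PowerSeries.coeff a p • T b (v.coeff c))]
    exact Finset.sum_congr rfl fun x _ =>
      sum_antidiagonal_flip x.1 (fun a b => PowerSeries.coeff b p • T a (v.coeff x.2))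

theorem coeff_opSeries (T : ℕ → V →ₗ[ℂ] W) (v : Formal V) (n : ℕ) :
    (opSeries T v).coeff n
      = ∑ rs ∈ Finset.HasAntidiagonal.antidiagonal n, T rs.1 (v.coeff rs.2) := rfl

/-- The `ℂ[[lam]]`-linear extension of a linear map `T : V → W`, coefficient by coefficient. -/
def map (T : V →ₗ[ℂ] W) : Formal V →ₗ[ℂ⟦X⟧] Formal W where
  toFun v := ⟨fun n => T (v.coeff n)⟩
  map_add' v w := by ext n; simp
  map_smul' p v := by ext n; simp [coeff_smul]

@[simp] theorem coeff_map (T : V →ₗ[ℂ] W) (v : Formal V) (n : ℕ) :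
    (map T v).coeff n = T (v.coeff n) := rfl

end Formal

/-! ### Smooth complex-valued functions on a manifold and on a subset of it -/

section Functions

variable (m : ℕ) (M : Type*) [TopologicalSpace M] [ChartedSpace (EuclideanSpace ℝ (Fin m)) M]

/-- The algebra `C^∞(M)` of smooth complex-valued functions on `M`. -/
def smoothFun : Subalgebra ℂ (M → ℂ) where
  carrier := {f | ContMDiff (𝓡 m) 𝓘(ℝ, ℂ) ∞ f}
  mul_mem' {f g} hf hg := by
    have h : ContDiff ℝ ∞ (fun p : ℂ × ℂ => p.1 * p.2) := contDiff_mul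
    exact h.contMDiff.comp (hf.prodMk_space hg)
  add_mem' {f g} hf hg := hf.add hg
  algebraMap_mem' r := contMDiff_const

variable {M} in
/-- The algebra `C^∞(S)` for a subset `S` of `M`: the functions on `S` which near each point of `S`
extend to a smooth function on an open subset of `M`. If `S` is an embedded submanifold, these are
the smooth functions on the manifold `S`. -/
def smoothOn (S : Set M) : Subalgebra ℂ (S → ℂ) where
  carrier := {φ | ∀ c : S, ∃ U : Set M, IsOpen U ∧ (c : M) ∈ U ∧ ∃ F : M → ℂ,
    ContMDiffOn (𝓡 m) 𝓘(ℝ, ℂ) ∞ F U ∧ ∀ x : S, (x : M) ∈ U → φ x = F x}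
  mul_mem' {φ ψ} hφ hψ c := by
    obtain ⟨U, hU, hcU, F, hF, hFφ⟩ := hφ c
    obtain ⟨V, hV, hcV, G, hG, hGψ⟩ := hψ c
    have h : ContDiff ℝ ∞ (fun p : ℂ × ℂ => p.1 * p.2) := contDiff_mul
    refine ⟨U ∩ V, hU.inter hV, ⟨hcU, hcV⟩, fun x => F x * G x, ?_, ?_⟩
    · exact h.contMDiff.comp_contMDiffOn
        ((hF.mono Set.inter_subset_left).prodMk_space (hG.mono Set.inter_subset_right))
    · intro x hx
      rw [Pi.mul_apply, hFφ x hx.1, hGψ x hx.2]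
  add_mem' {φ ψ} hφ hψ c := by
    obtain ⟨U, hU, hcU, F, hF, hFφ⟩ := hφ c
    obtain ⟨V, hV, hcV, G, hG, hGψ⟩ := hψ c
    refine ⟨U ∩ V, hU.inter hV, ⟨hcU, hcV⟩, fun x => F x + G x, ?_, ?_⟩
    · exact (hF.mono Set.inter_subset_left).add (hG.mono Set.inter_subset_right)
    · intro x hx
      rw [Pi.add_apply, hFφ x hx.1, hGψ x hx.2]
  algebraMap_mem' r c :=
    ⟨Set.univ, isOpen_univ, trivial, fun _ => r, contMDiffOn_const, fun _ _ => rfl⟩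

instance : AddCommGroup (smoothFun m M) := inferInstance

instance : Module ℝ (smoothFun m M) := inferInstance

instance : Module ℂ (smoothFun m M) := inferInstance

instance : IsScalarTower ℝ ℂ (smoothFun m M) := inferInstance

variable {M} in
/-- The restriction `ι^* : C^∞(M) → C^∞(S)`. -/
def restrict (S : Set M) : smoothFun m M →ₗ[ℂ] smoothOn m S where
  toFun f := ⟨fun c => f.1 c, fun _ =>
    ⟨Set.univ, isOpen_univ, trivial, f.1, f.2.contMDiffOn, fun _ _ => rfl⟩⟩
  map_add' _ _ := rfl
  map_smul' _ _ := rfl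

/-! ### Poisson brackets and star products -/

/-- A Poisson structure on `M`, given by its bracket on `C^∞(M)`. -/
structure PoissonStructure where
  bracket : smoothFun m M →ₗ[ℂ] smoothFun m M →ₗ[ℂ] smoothFun m M
  bracket_self : ∀ f, bracket f f = 0
  leibniz : ∀ f g h, bracket f (g * h) = bracket f g * h + g * bracket f h
  jacobi : ∀ f g h,
    bracket f (bracket g h) = bracket (bracket f g) h + bracket g (bracket f h)

variable {m M}

/-- The maximal ideal of the functions which vanish at `x`. -/
def vanishAt (x : M) : Ideal (smoothFun m M) :=
  RingHom.ker ((Pi.evalRingHom (fun _ : M => ℂ) x).comp (smoothFun m M).val.toRingHom)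

/-- A bilinear operator is bidifferential if, locally on `M`, its value at a point depends only
on the jets of its two arguments at that point up to some fixed order `k`, the functions whose
`k`-jet at `y` is zero being the elements of the `(k + 1)`-st power of the ideal of `y`. -/
def IsBidifferential (B : smoothFun m M →ₗ[ℂ] smoothFun m M →ₗ[ℂ] smoothFun m M) : Prop :=
  ∀ x : M, ∃ k : ℕ, ∀ᶠ y in 𝓝 x, ∀ f g : smoothFun m M,
    (f ∈ (vanishAt y : Ideal (smoothFun m M)) ^ (k + 1) ∨
      g ∈ (vanishAt y : Ideal (smoothFun m M)) ^ (k + 1)) → (B f g).1 y = 0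

/-- The product `f * g = ∑ lam ^ r * C r (f, g)` on `C^∞(M)[[lam]]`, extended
`ℂ[[lam]]`-bilinearly. -/
def starMul (C : ℕ → smoothFun m M →ₗ[ℂ] smoothFun m M →ₗ[ℂ] smoothFun m M)
    (f g : Formal (smoothFun m M)) : Formal (smoothFun m M) :=
  ⟨fun n => ∑ rs ∈ Finset.HasAntidiagonal.antidiagonal n,
    ∑ ij ∈ Finset.HasAntidiagonal.antidiagonal rs.2, C rs.1 (f.coeff ij.1) (g.coeff ij.2)⟩

/-- A star product for the Poisson structure `P`. -/
structure StarProduct (P : PoissonStructure m M) where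
  C : ℕ → smoothFun m M →ₗ[ℂ] smoothFun m M →ₗ[ℂ] smoothFun m M
  C_zero : ∀ f g, C 0 f g = f * g
  C_one : ∀ f g, C 1 f g - C 1 g f = Complex.I • P.bracket f g
  bidifferential : ∀ r, IsBidifferential (C r)
  one_left : ∀ r f, C (r + 1) 1 f = 0
  one_right : ∀ r f, C (r + 1) f 1 = 0
  assoc : ∀ f g h, starMul C (starMul C f g) h = starMul C f (starMul C g h)

/-- The coefficients of the formal series of operators `F ↦ F * G`
(right star multiplication by `G`). -/
def rightMul (C : ℕ → smoothFun m M →ₗ[ℂ] smoothFun m M →ₗ[ℂ] smoothFun m M)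
    (G : Formal (smoothFun m M)) (r : ℕ) : smoothFun m M →ₗ[ℂ] smoothFun m M :=
  ∑ st ∈ Finset.HasAntidiagonal.antidiagonal r, (C st.1).flip (G.coeff st.2)

theorem opSeries_rightMul (C : ℕ → smoothFun m M →ₗ[ℂ] smoothFun m M →ₗ[ℂ] smoothFun m M)
    (F G : Formal (smoothFun m M)) :
    Formal.opSeries (rightMul C G) F = starMul C F G := by
  ext1
  funext n
  simp only [Formal.coeff_opSeries, rightMul, LinearMap.sum_apply, LinearMap.flip_apply, starMul]
  rw [Formal.sum_antidiagonal_assoc n (fun a b c => C a (F.coeff c) (G.coeff b))]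
  exact Finset.sum_congr rfl fun x _ =>
    Formal.sum_antidiagonal_flip x.2 (fun b c => C x.1 (F.coeff c) (G.coeff b))

/-! ### Momentum maps -/

section Momentum

variable {g : Type*} [LieRing g] [LieAlgebra ℝ g]

/-- A map `M → g^*` is smooth if all its components `⟨J, ξ⟩` are smooth. -/
def IsSmoothMap (m : ℕ) {M : Type*} [TopologicalSpace M]
    [ChartedSpace (EuclideanSpace ℝ (Fin m)) M] {g : Type*} [LieRing g] [LieAlgebra ℝ g]
    (J : M → Module.Dual ℝ g) : Prop :=
  ∀ ξ : g, ContMDiff (𝓡 m) 𝓘(ℝ, ℝ) ∞ (fun x => J x ξ)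

/-- The function `⟨J, ξ⟩ ∈ C^∞(M)`. -/
def pairing (J : M → Module.Dual ℝ g) (hJ : IsSmoothMap m J) (ξ : g) : smoothFun m M :=
  ⟨fun x => ((J x ξ : ℝ) : ℂ), Complex.ofRealCLM.contDiff.contMDiff.comp (hJ ξ)⟩

/-- The series `∑ lam ^ r * ⟨J r, ξ⟩ ∈ C^∞(M)[[lam]]`. -/
def pairingSeries (J : ℕ → M → Module.Dual ℝ g) (hJ : ∀ r, IsSmoothMap m (J r)) (ξ : g) :
    Formal (smoothFun m M) :=
  ⟨fun r => pairing (J r) (hJ r) ξ⟩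

/-- Zero is a regular value of `J : M → g^*`: the differential of `J` at each point of `J⁻¹(0)` is
a surjection of the tangent space onto `g^*`. -/
def ZeroIsRegularValue (m : ℕ) {M : Type*} [TopologicalSpace M]
    [ChartedSpace (EuclideanSpace ℝ (Fin m)) M] {g : Type*} [LieRing g] [LieAlgebra ℝ g]
    (J : M → Module.Dual ℝ g) : Prop :=
  ∀ x : M, J x = 0 → ∀ l : Module.Dual ℝ g, ∃ v : TangentSpace (𝓡 m) x, ∀ ξ : g,
    (mfderiv (𝓡 m) 𝓘(ℝ, ℝ) (fun y => J y ξ) x v : ℝ) = l ξ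

/-- A quantum momentum map `∑ lam ^ r * J r`; together with the star product it makes `M` a
Hamiltonian quantum `g`-space. -/
structure QuantumMomentumMap {P : PoissonStructure m M} (S : StarProduct P)
    (g : Type*) [LieRing g] [LieAlgebra ℝ g] where
  J : ℕ → M → Module.Dual ℝ g
  smooth : ∀ r, IsSmoothMap m (J r)
  covariant : ∀ ξ η : g,
    starMul S.C (pairingSeries J smooth ξ) (pairingSeries J smooth η)
      - starMul S.C (pairingSeries J smooth η) (pairingSeries J smooth ξ)
      = (Complex.I • (PowerSeries.X : ℂ⟦X⟧)) • pairingSeries J smooth ⁅ξ, η⁆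

/-- The constraint surface `J⁻¹(0)`. -/
def zeroSet (J : M → Module.Dual ℝ g) : Set M := {x | J x = 0}

end Momentum

end Functions

/-! ### Operators on the Grassmann algebra -/

section Grassmann

variable {g : Type*} [LieRing g] [LieAlgebra ℝ g]

theorem contractLeft_mem (d : Module.Dual ℝ g) (i : ℕ) (x : ExteriorAlgebra ℝ g)
    (hx : x ∈ ⋀[ℝ]^(i + 1) g) :
    CliffordAlgebra.contractLeft (Q := (0 : QuadraticForm ℝ g)) d x ∈ ⋀[ℝ]^i g := by
  induction i generalizing x with
  | zero =>
    simp only [zero_add, ExteriorAlgebra.exteriorPower, pow_one, LinearMap.mem_range] at hx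
    obtain ⟨y, rfl⟩ := hx
    erw [CliffordAlgebra.contractLeft_ι]
    simp only [ExteriorAlgebra.exteriorPower, pow_zero]
    exact Submodule.algebraMap_mem _
  | succ i ih =>
    rw [ExteriorAlgebra.exteriorPower, pow_succ'] at hx
    induction hx using Submodule.mul_induction_on' with
    | mem_mul_mem a ha b hb =>
      obtain ⟨y, rfl⟩ := ha
      erw [CliffordAlgebra.contractLeft_ι_mul]
      refine Submodule.sub_mem _ (Submodule.smul_mem _ _ hb) ?_
      rw [ExteriorAlgebra.exteriorPower, pow_succ']
      exact Submodule.mul_mem_mul ⟨y, rfl⟩ (ih b hb)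
    | add a _ b _ ha hb =>
      rw [map_add]
      exact Submodule.add_mem _ ha hb

/-- The left insertion (interior product) `i(d) : ⋀^(i+1) g → ⋀^i g` of `d ∈ g^*`. -/
def insertion (d : Module.Dual ℝ g) (i : ℕ) : ⋀[ℝ]^(i + 1) g →ₗ[ℝ] ⋀[ℝ]^i g :=
  (CliffordAlgebra.contractLeft (Q := (0 : QuadraticForm ℝ g)) d).restrict (contractLeft_mem d i)

/-- Exterior multiplication `ξ ∧ · : ⋀^i g → ⋀^(i+1) g`. -/
def wedge (ξ : g) (i : ℕ) : ⋀[ℝ]^i g →ₗ[ℝ] ⋀[ℝ]^(i + 1) g :=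
  (LinearMap.mulLeft ℝ (ExteriorAlgebra.ι ℝ ξ)).restrict (fun x hx => by
    rw [ExteriorAlgebra.exteriorPower, pow_succ']
    exact Submodule.mul_mem_mul ⟨ξ, rfl⟩ hx)

variable {n : ℕ} (e : Module.Basis (Fin n) ℝ g)

attribute [local instance] LieRing.ofAssociativeRing

/-- The structure constants: the `e c`-component of `⁅e a, e b⁆`. -/
def structureConst (c a b : Fin n) : ℝ := e.coord c ⁅e a, e b⁆

/-- The operator `q = - (1/2) ∑ f^c_{ab} e_c ∧ i(e^a) i(e^b)`, that is
`q (ξ_1 ∧ ... ∧ ξ_l) = ∑_{i<j} (-1)^(i+j-1) ⁅ξ_i, ξ_j⁆ ∧ ξ_1 ∧ ... (omit ξ_i, ξ_j) ... ∧ ξ_l`. -/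
def qOp : (i : ℕ) → ⋀[ℝ]^(i + 1) g →ₗ[ℝ] ⋀[ℝ]^i g
  | 0 => 0
  | i + 1 => (-(1 / 2) : ℝ) • ∑ a, ∑ b, ∑ c, structureConst e c a b •
      (wedge (e c) i ∘ₗ insertion (e.coord a) i ∘ₗ insertion (e.coord b) (i + 1))

/-- The operator `u`: insertion of the linear form `ξ ↦ tr (ad ξ)`,
equivalently `∑ f^b_{ab} i(e^a)`. -/
def uOp (g : Type*) [LieRing g] [LieAlgebra ℝ g] (i : ℕ) : ⋀[ℝ]^(i + 1) g →ₗ[ℝ] ⋀[ℝ]^i g :=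
  insertion (LinearMap.trace ℝ g ∘ₗ (LieAlgebra.ad ℝ g).toLinearMap) i

/-- The sign `α ↦ (-1)^k α` for `α ∈ ⋀^k g^*`. -/
def ghostSign (g : Type*) [LieRing g] [LieAlgebra ℝ g] :
    ExteriorAlgebra ℝ (Module.Dual ℝ g) →ₗ[ℝ] ExteriorAlgebra ℝ (Module.Dual ℝ g) :=
  (CliffordAlgebra.involute (Q := (0 : QuadraticForm ℝ (Module.Dual ℝ g)))).toLinearMap

/-- `WithGhosts g V = ⋀ g^* ⊗ V` (with the factors in the other order). -/
abbrev WithGhosts (g : Type*) [LieRing g] [LieAlgebra ℝ g] (V : Type*) [AddCommGroup V]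
    [Module ℝ V] : Type _ :=
  V ⊗[ℝ] ExteriorAlgebra ℝ (Module.Dual ℝ g)

/-- The extension `α ⊗ v ↦ (-1)^k α ⊗ T v`, for `α ∈ ⋀^k g^*`, of a linear map `T : V → W`. -/
def ext (g : Type*) [LieRing g] [LieAlgebra ℝ g] {V W : Type*}
    [AddCommGroup V] [Module ℝ V] [Module ℂ V] [IsScalarTower ℝ ℂ V]
    [AddCommGroup W] [Module ℝ W] [Module ℂ W] [IsScalarTower ℝ ℂ W] (T : V →ₗ[ℂ] W) :
    WithGhosts g V →ₗ[ℂ] WithGhosts g W :=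
  TensorProduct.AlgebraTensorModule.map T (ghostSign g)

end Grassmann

/-! ### The classical and the quantised Koszul complex -/

section Koszul

variable (m : ℕ) (M : Type*) [TopologicalSpace M] [ChartedSpace (EuclideanSpace ℝ (Fin m)) M]
  (g : Type*) [LieRing g] [LieAlgebra ℝ g]

/-- `⋀^i g ⊗ C^∞(M)` (with the factors in the other order). -/
abbrev KoszulSpace (i : ℕ) : Type _ := smoothFun m M ⊗[ℝ] ⋀[ℝ]^i g

instance (i : ℕ) : AddCommGroup (KoszulSpace m M g i) := inferInstance

instance (i : ℕ) : Module ℝ (KoszulSpace m M g i) := inferInstance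

instance (i : ℕ) : Module ℂ (KoszulSpace m M g i) := inferInstance

instance (i : ℕ) : IsScalarTower ℝ ℂ (KoszulSpace m M g i) := inferInstance

/-- The canonical identification `⋀^0 g ⊗ C^∞(M) = C^∞(M)`. -/
def degZero : KoszulSpace m M g 0 ≃ₗ[ℂ] smoothFun m M :=
  (TensorProduct.AlgebraTensorModule.congr (LinearEquiv.refl ℂ (smoothFun m M))
    (exteriorPower.zeroEquiv ℝ g)).trans (TensorProduct.AlgebraTensorModule.rid ℝ ℂ (smoothFun m M))

variable {m M g}
variable {n : ℕ} (e : Module.Basis (Fin n) ℝ g)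

/-- The classical Koszul boundary operator `i(J) : ⋀^(i+1) g ⊗ C^∞(M) → ⋀^i g ⊗ C^∞(M)`. -/
def koszul (J : M → Module.Dual ℝ g) (hJ : IsSmoothMap m J) (i : ℕ) :
    KoszulSpace m M g (i + 1) →ₗ[ℂ] KoszulSpace m M g i :=
  ∑ a, TensorProduct.AlgebraTensorModule.map
    (LinearMap.mulLeft ℂ (pairing J hJ (e a))) (insertion (e.coord a) i)

/-- A chain homotopy for the augmented classical Koszul complex: a prolongation map
`prol : C^∞(C) → C^∞(M)` and maps `h i : ⋀^i g ⊗ C^∞(M) → ⋀^(i+1) g ⊗ C^∞(M)`, with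
`h_0 ∘ prol = 0`. -/
structure ClassicalHomotopy (J : M → Module.Dual ℝ g) (hJ : IsSmoothMap m J) where
  prol : smoothOn m (zeroSet J) →ₗ[ℂ] smoothFun m M
  h : (i : ℕ) → KoszulSpace m M g i →ₗ[ℂ] KoszulSpace m M g (i + 1)
  restrict_prol : restrict m (zeroSet J) ∘ₗ prol = LinearMap.id
  homotopy_zero :
    (degZero m M g).symm.toLinearMap ∘ₗ prol ∘ₗ restrict m (zeroSet J) ∘ₗ
      (degZero m M g).toLinearMap + koszul e J hJ 0 ∘ₗ h 0 = LinearMap.id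
  homotopy_succ : ∀ i,
    h i ∘ₗ koszul e J hJ i + koszul e J hJ (i + 1) ∘ₗ h (i + 1) = LinearMap.id
  h_zero_prol : h 0 ∘ₗ (degZero m M g).symm.toLinearMap ∘ₗ prol = 0

/-- The antighost degree `i` part `⋀ g^* ⊗ ⋀^i g ⊗ C^∞(M)` of the BRST algebra. -/
abbrev BRST (m : ℕ) (M : Type*) [TopologicalSpace M]
    [ChartedSpace (EuclideanSpace ℝ (Fin m)) M] (g : Type*) [LieRing g] [LieAlgebra ℝ g]
    (i : ℕ) : Type _ := WithGhosts g (KoszulSpace m M g i)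

instance (i : ℕ) : AddCommGroup (BRST m M g i) := inferInstance

instance (i : ℕ) : Module ℂ (BRST m M g i) := inferInstance

variable {P : PoissonStructure m M} {S : StarProduct P} (Q : QuantumMomentumMap S g)

/-- The coefficient of `lam ^ r` of the quantised Koszul operator on `⋀^(i+1) g ⊗ C^∞(M)`: that of
`x ⊗ F ↦ ∑ i(e^a) x ⊗ (F * J_a) + i lam ((1/2) u - q) x ⊗ F`. -/
def qKoszulCoeff (i r : ℕ) : KoszulSpace m M g (i + 1) →ₗ[ℂ] KoszulSpace m M g i :=
  ∑ a, TensorProduct.AlgebraTensorModule.map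
      (rightMul S.C (pairingSeries Q.J Q.smooth (e a)) r) (insertion (e.coord a) i)
    + if r = 1 then Complex.I • TensorProduct.AlgebraTensorModule.map LinearMap.id
        ((1 / 2 : ℝ) • uOp g i - qOp e i) else 0

/-- The quantised Koszul operator on the BRST algebra, from antighost degree `i + 1` to `i`. -/
def qKoszul (i : ℕ) : Formal (BRST m M g (i + 1)) →ₗ[ℂ⟦X⟧] Formal (BRST m M g i) :=
  Formal.opSeries fun r => ext g (qKoszulCoeff e Q i r)

/-- The classical Koszul operator of `J 0` on the BRST algebra, extended to formal series. -/
def cKoszul (i : ℕ) : Formal (BRST m M g (i + 1)) →ₗ[ℂ⟦X⟧] Formal (BRST m M g i) :=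
  Formal.map (ext g (koszul e (Q.J 0) (Q.smooth 0) i))

/-- The operator `B_1 = (1 / lam) * (cKoszul - qKoszul)` on antighost degree one
(the two operators agree in order zero, see `lam_smul_B1`). -/
def B1 : Formal (BRST m M g 1) →ₗ[ℂ⟦X⟧] Formal (BRST m M g 0) :=
  Formal.opSeries fun r => -ext g (qKoszulCoeff e Q 0 (r + 1))

theorem qKoszulCoeff_zero (i : ℕ) :
    qKoszulCoeff e Q i 0 = koszul e (Q.J 0) (Q.smooth 0) i := by
  have h : ∀ a, rightMul S.C (pairingSeries Q.J Q.smooth (e a)) 0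
      = LinearMap.mulLeft ℂ (pairing (Q.J 0) (Q.smooth 0) (e a)) := by
    intro a
    ext1 f
    simp [rightMul, pairingSeries, S.C_zero, mul_comm]
  simp [qKoszulCoeff, koszul, h]

theorem lam_smul_B1 :
    (PowerSeries.X : ℂ⟦X⟧) • B1 e Q = cKoszul e Q 0 - qKoszul e Q 0 := by
  ext1 v
  ext1
  funext k
  rw [LinearMap.smul_apply, LinearMap.sub_apply, Formal.coeff_smul, Formal.coeff_sub]
  cases k with
  | zero => simp [cKoszul, qKoszul, Formal.coeff_opSeries, qKoszulCoeff_zero]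
  | succ k =>
    rw [Finset.sum_eq_single (1, k)]
    · simp [cKoszul, qKoszul, B1, Formal.coeff_opSeries, Finset.Nat.antidiagonal_succ,
        qKoszulCoeff_zero]
    · rintro ⟨a, b⟩ h hne
      have ha : a ≠ 1 := by
        rintro rfl
        simp only [Finset.HasAntidiagonal.mem_antidiagonal] at h
        exact hne (by rw [show b = k by omega])
      simp [PowerSeries.coeff_X, ha]
    · intro h
      exact absurd (by simp [add_comm]) h

instance : AddCommGroup (WithGhosts g (smoothOn m (zeroSet (Q.J 0)))) := inferInstance

instance : Module ℂ (WithGhosts g (smoothOn m (zeroSet (Q.J 0)))) := inferInstance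

variable {e} (H : ClassicalHomotopy e (Q.J 0) (Q.smooth 0))

/-- The space `(⋀ g^* ⊗ C^∞(C))[[lam]]`, the augmentation part of the complex. -/
abbrev Augmentation : Type _ :=
  Formal (WithGhosts g (smoothOn m (zeroSet (Q.J 0))))

/-- The classical restriction `ι^*` on `(⋀ g^* ⊗ C^∞(M))[[lam]]`. -/
def cRestr : Formal (BRST m M g 0) →ₗ[ℂ⟦X⟧] Augmentation Q :=
  Formal.map (ext g (restrict m (zeroSet (Q.J 0)) ∘ₗ (degZero m M g).toLinearMap))

/-- The classical prolongation on `(⋀ g^* ⊗ C^∞(C))[[lam]]`. -/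
def cProl : Augmentation Q →ₗ[ℂ⟦X⟧] Formal (BRST m M g 0) :=
  Formal.map (ext g ((degZero m M g).symm.toLinearMap ∘ₗ H.prol))

/-- The classical homotopies on the BRST algebra, extended to formal series. -/
def cHomotopy (i : ℕ) : Formal (BRST m M g i) →ₗ[ℂ⟦X⟧] Formal (BRST m M g (i + 1)) :=
  Formal.map (ext g (H.h i))

/-- The operator `id - lam * B_1 h_0`. -/
def oneSubB1h0 : Module.End ℂ⟦X⟧ (Formal (BRST m M g 0)) :=
  1 - (PowerSeries.X : ℂ⟦X⟧) • (B1 e Q ∘ₗ cHomotopy Q H 0)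

/-- The deformed restriction map `ι^* (id - lam * B_1 h_0)⁻¹`. -/
def qRestr : Formal (BRST m M g 0) →ₗ[ℂ⟦X⟧] Augmentation Q :=
  cRestr Q ∘ₗ Ring.inverse (oneSubB1h0 Q H)

/-- The classical homotopy composed with the quantised boundary operators: in degree `0` this is
`prol qRestr + qKoszul_1 h_0`, in degree `i ≥ 1` it is `h_{i-1} qKoszul_i + qKoszul_{i+1} h_i`. -/
def mixed : (i : ℕ) → Module.End ℂ⟦X⟧ (Formal (BRST m M g i))
  | 0 => cProl Q H ∘ₗ qRestr Q H + qKoszul e Q 0 ∘ₗ cHomotopy Q H 0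
  | i + 1 => cHomotopy Q H i ∘ₗ qKoszul e Q i + qKoszul e Q (i + 1) ∘ₗ cHomotopy Q H (i + 1)

/-- The deformed homotopies `h_i ∘ (mixed i)⁻¹`. -/
def qHomotopy (i : ℕ) : Formal (BRST m M g i) →ₗ[ℂ⟦X⟧] Formal (BRST m M g (i + 1)) :=
  cHomotopy Q H i ∘ₗ Ring.inverse (mixed Q H i)

/-- The augmented quantum BRST complex: the augmentation part and the parts of antighost degree
`i = 0, 1, 2, ...`. Since the part of degree `i` is zero for `i > dim g`, the product over all
`i` is the direct sum. -/
abbrev AugmentedComplex : Type _ := Augmentation Q × ((i : ℕ) → Formal (BRST m M g i))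

/-- The boundary operator of the augmented quantum complex: `qRestr` on antighost degree zero,
`qKoszul` on positive antighost degree, and zero on the augmentation part. -/
def augBoundary : AugmentedComplex Q →ₗ[ℂ⟦X⟧] AugmentedComplex Q :=
  LinearMap.prod
    (qRestr Q H ∘ₗ LinearMap.proj 0 ∘ₗ LinearMap.snd ℂ⟦X⟧ _ _)
    (LinearMap.pi fun i => qKoszul e Q i ∘ₗ LinearMap.proj (i + 1) ∘ₗ LinearMap.snd ℂ⟦X⟧ _ _)

/-- The components of the quantised chain homotopy: `prol` on the augmentation part, `qHomotopy i`
on antighost degree `i`. -/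
def augHomotopyComponent : (i : ℕ) → AugmentedComplex Q →ₗ[ℂ⟦X⟧] Formal (BRST m M g i)
  | 0 => cProl Q H ∘ₗ LinearMap.fst ℂ⟦X⟧ _ _
  | i + 1 => qHomotopy Q H i ∘ₗ LinearMap.proj i ∘ₗ LinearMap.snd ℂ⟦X⟧ _ _

/-- The quantised chain homotopy on the augmented quantum complex. -/
def augHomotopy : AugmentedComplex Q →ₗ[ℂ⟦X⟧] AugmentedComplex Q :=
  LinearMap.prod 0 (LinearMap.pi (augHomotopyComponent Q H))

end Koszul

end QuantumKoszul

end

noncomputable section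

namespace QuantumKoszul

/-! ### Formal power series and inversion of perturbations of the identity -/

namespace Formal

variable {V W U : Type*} [AddCommGroup V] [Module ℂ V] [AddCommGroup W] [Module ℂ W]
  [AddCommGroup U] [Module ℂ U]

/-! There are two independent halves: a homological perturbation argument, valid for any classical
homotopy, and the exactness of the classical augmented Koszul complex, which provides one.

Perturbation. Every operator `1 - X • D` on formal series is invertible by a geometric series
(`Formal.isUnit_one_sub_X_smul`); linearity over the power series ring replaces any continuity
assumption on `D`. Write p, r, h, d for prolongation, restriction, classical homotopy and quantum
boundary. The classical homotopy identities turn `oneSubB1h0` into N = p r + d h, and show that it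
and all `mixed` operators have the form `1 - X • D`. Since r p = id and h p = 0, N fixes the image
of p. Hence the deformed restriction r N⁻¹ is still a left inverse of p, and h may be corrected by
either inverse. Everything else follows from d d = 0: it makes r N⁻¹ d vanish and makes the `mixed`
operators commute with d, so that correcting each homotopy by its inverse gives a contraction.
Exactness is then immediate.

The identity d d = 0 (`qKoszul_comp_qKoszul`) is a cancellation. Since insertions anticommute, the
square of the momentum part sees only commutators of right star multiplications, and quantum
covariance evaluates these as the structure constants times the momentum components. The cross terms
with (1/2) u - q give the same expression with opposite sign. The square of (1/2) u - q itself
vanishes by q q = 0 (Jacobi), u u = 0, and u q + q u = 0 (the trace of ad kills brackets).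

Classical exactness. Near a point of the zero set, regularity makes the components of J part of a
linear coordinate system. There Hadamard division by each coordinate gives a homotopy between the
identity and restriction to a hyperplane. Doing this for all coordinates leaves nothing in positive
degree and only restriction to the zero set in degree zero. At other points some component of J is
nonzero, and multiplication by it is null-homotopic. Partitions of unity glue the local primitives
(`exists_preimage_of_local`), and an exact complex of vector spaces is contractible
(`exists_contracting_homotopy`). -/

theorem coeff_X_pow_smul (N : ℕ) (v : Formal V) (n : ℕ) :
    ((PowerSeries.X : ℂ⟦X⟧) ^ N • v).coeff n = if N ≤ n then v.coeff (n - N) else 0 := by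
  rw [coeff_smul]
  split_ifs with h
  · rw [Finset.sum_eq_single (N, n - N)]
    · simp [PowerSeries.coeff_X_pow]
    · rintro ⟨a, b⟩ hab hne
      have ha : a ≠ N := by
        rintro rfl
        simp only [Finset.HasAntidiagonal.mem_antidiagonal] at hab
        exact hne (by rw [show b = n - a by omega])
      simp [PowerSeries.coeff_X_pow, ha]
    · intro hn
      exact absurd (by simp; omega) hn
  · refine Finset.sum_eq_zero fun x hx => ?_
    simp only [Finset.HasAntidiagonal.mem_antidiagonal] at hx
    rw [PowerSeries.coeff_X_pow, if_neg (by omega), zero_smul]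

theorem exists_eq_X_pow_smul (N : ℕ) (v : Formal V) (hv : ∀ n < N, v.coeff n = 0) :
    ∃ w : Formal V, v = (PowerSeries.X : ℂ⟦X⟧) ^ N • w := by
  refine ⟨⟨fun n => v.coeff (n + N)⟩, ?_⟩
  ext n
  rw [coeff_X_pow_smul]
  split_ifs with h
  · simp [h]
  · exact hv n (by omega)

/-- A perturbation of the identity by a multiple of the formal parameter is invertible. -/
theorem isUnit_one_sub_X_smul (D : Module.End ℂ⟦X⟧ (Formal V)) :
    IsUnit (1 - (PowerSeries.X : ℂ⟦X⟧) • D) := by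
  set E : Module.End ℂ⟦X⟧ (Formal V) := (PowerSeries.X : ℂ⟦X⟧) • D with hE
  have hpow : ∀ k v n, n < k → ((E ^ k) v).coeff n = 0 := by
    intro k v n hn
    rw [hE, smul_pow, LinearMap.smul_apply, coeff_X_pow_smul, if_neg (by omega)]
  rw [Module.End.isUnit_iff]
  constructor
  · rw [injective_iff_map_eq_zero]
    intro v hv
    have hfix : E v = v := by
      rw [LinearMap.sub_apply, Module.End.one_apply, sub_eq_zero] at hv
      exact hv.symm
    have hfix' : ∀ k, (E ^ k) v = v := by
      intro k
      induction k with
      | zero => simp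
      | succ k ih => rw [pow_succ, Module.End.mul_apply, hfix, ih]
    ext n
    rw [← hfix' (n + 1), hpow _ _ _ (Nat.lt_succ_self n), coeff_zero]
  · intro v
    have hsum : ∀ (N n : ℕ), (∑ k ∈ Finset.range N, (E ^ k) v).coeff n
        = ∑ k ∈ Finset.range N, ((E ^ k) v).coeff n := by
      intro N n
      induction N with
      | zero => simp
      | succ N ih => rw [Finset.sum_range_succ, Finset.sum_range_succ, coeff_add, ih]
    -- The geometric series, truncated coefficientwise: powers above n have no coefficient of order
    -- n.
    let w : Formal V := ⟨fun n => ∑ k ∈ Finset.range (n + 1), ((E ^ k) v).coeff n⟩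
    have hw : ∀ N n, n < N → (w - ∑ k ∈ Finset.range N, (E ^ k) v).coeff n = 0 := by
      intro N n hn
      rw [coeff_sub, hsum, sub_eq_zero]
      refine Finset.sum_subset (Finset.range_mono hn) fun k _ hk => hpow _ _ _ ?_
      simp only [Finset.mem_range, not_lt] at hk
      omega
    refine ⟨w, ?_⟩
    ext n
    -- Up to a multiple of `X ^ (n + 1)`, which the linear map `1 - E` preserves, the limit is a
    -- finite geometric sum, and this telescopes.
    obtain ⟨w', hw'⟩ := exists_eq_X_pow_smul (n + 1) _ (hw (n + 1))
    have hdec : w = ∑ k ∈ Finset.range (n + 1), (E ^ k) v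
        + (PowerSeries.X : ℂ⟦X⟧) ^ (n + 1) • w' := by rw [← hw']; abel
    have htel : (1 - E) (∑ k ∈ Finset.range (n + 1), (E ^ k) v) = v - (E ^ (n + 1)) v := by
      have := congrArg (fun T : Module.End ℂ⟦X⟧ (Formal V) => T v) (mul_neg_geom_sum E (n + 1))
      simpa [LinearMap.sum_apply] using this
    rw [hdec, map_add, map_smul, htel, coeff_add, coeff_X_pow_smul, if_neg (by omega),
      coeff_sub, hpow _ _ _ (Nat.lt_succ_self n)]
    simp

theorem opSeries_comp (T : ℕ → W →ₗ[ℂ] U) (T' : ℕ → V →ₗ[ℂ] W) :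
    opSeries T ∘ₗ opSeries T' = opSeries fun n =>
      ∑ rs ∈ Finset.HasAntidiagonal.antidiagonal n, T rs.1 ∘ₗ T' rs.2 := by
  ext v n
  simp only [LinearMap.comp_apply, coeff_opSeries, map_sum, LinearMap.sum_apply]
  exact (sum_antidiagonal_assoc n fun a b c => T a (T' b (v.coeff c))).symm

/-- Applied to a constant series v, the operator series has n-th coefficient `T n v`. This lets
identities of operators on formal series be read order by order. -/
theorem opSeries_injective : Function.Injective (opSeries (V := V) (W := W)) := by
  intro T T' h
  funext n
  ext v
  have := congrArg (fun L => (L ⟨fun k => if k = 0 then v else 0⟩).coeff n) h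
  simp only [coeff_opSeries] at this
  rwa [Finset.sum_eq_single (n, 0), Finset.sum_eq_single (n, 0)] at this
  all_goals first
    | (rintro ⟨a, b⟩ hab hne
       have hb : b ≠ 0 := by
         rintro rfl
         simp only [Finset.HasAntidiagonal.mem_antidiagonal, add_zero] at hab
         exact hne (by rw [hab])
       simp [hb])
    | simp

theorem opSeries_zero : opSeries (fun _ => (0 : V →ₗ[ℂ] W)) = 0 := by
  ext v n
  simp [coeff_opSeries]

theorem map_comp (T : W →ₗ[ℂ] U) (T' : V →ₗ[ℂ] W) : map (T ∘ₗ T') = map T ∘ₗ map T' := rfl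

theorem map_add (T T' : V →ₗ[ℂ] W) : map (T + T') = map T + map T' := rfl

theorem map_id : map (LinearMap.id : V →ₗ[ℂ] V) = LinearMap.id := rfl

theorem map_zero : map (0 : V →ₗ[ℂ] W) = 0 := rfl

end Formal

/-! ### Signed extension to the ghost factor -/

section Ghosts

variable {g : Type*} [LieRing g] [LieAlgebra ℝ g] {V W U : Type*}
    [AddCommGroup V] [Module ℝ V] [Module ℂ V] [IsScalarTower ℝ ℂ V]
    [AddCommGroup W] [Module ℝ W] [Module ℂ W] [IsScalarTower ℝ ℂ W]
    [AddCommGroup U] [Module ℝ U] [Module ℂ U] [IsScalarTower ℝ ℂ U]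

theorem ghostSign_comp_ghostSign : ghostSign g ∘ₗ ghostSign g = LinearMap.id := by
  exact LinearMap.ext fun x =>
    CliffordAlgebra.involute_involute (Q := (0 : QuadraticForm ℝ (Module.Dual ℝ g))) x

/-- The extension `α ⊗ v ↦ α ⊗ T v` of a linear map `T : V → W`. -/
def evenExt (g : Type*) [LieRing g] [LieAlgebra ℝ g] {V W : Type*}
    [AddCommGroup V] [Module ℝ V] [Module ℂ V] [IsScalarTower ℝ ℂ V]
    [AddCommGroup W] [Module ℝ W] [Module ℂ W] [IsScalarTower ℝ ℂ W] :
    (V →ₗ[ℂ] W) →ₗ[ℂ] WithGhosts g V →ₗ[ℂ] WithGhosts g W where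
  toFun T := TensorProduct.AlgebraTensorModule.map T LinearMap.id
  map_add' _ _ := TensorProduct.AlgebraTensorModule.map_add_left _ _ _
  map_smul' _ _ := TensorProduct.AlgebraTensorModule.map_smul_left _ _ _

/-- The two signs (-1)^k cancel. A product of two odd extensions is thus an even one, and `evenExt`
is linear, so classical identities quadratic in the operators carry over. -/
theorem ext_comp (T : W →ₗ[ℂ] U) (T' : V →ₗ[ℂ] W) :
    ext g T ∘ₗ ext g T' = evenExt g (T ∘ₗ T') := by
  simp only [ext, evenExt, LinearMap.coe_mk, AddHom.coe_mk]
  rw [← TensorProduct.AlgebraTensorModule.map_comp, ghostSign_comp_ghostSign]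

theorem evenExt_id : evenExt g (LinearMap.id : V →ₗ[ℂ] V) = LinearMap.id :=
  TensorProduct.AlgebraTensorModule.map_id

end Ghosts

section LinearMapSums

variable {R A B C ι : Type*} [CommSemiring R] [AddCommMonoid A] [AddCommMonoid B]
  [AddCommMonoid C] [Module R A] [Module R B] [Module R C]

theorem sum_linearMap_comp (s : Finset ι) (T : ι → B →ₗ[R] C) (T' : A →ₗ[R] B) :
    (∑ i ∈ s, T i) ∘ₗ T' = ∑ i ∈ s, T i ∘ₗ T' := by
  ext x; simp [LinearMap.sum_apply]

theorem linearMap_comp_sum (s : Finset ι) (T : B →ₗ[R] C) (T' : ι → A →ₗ[R] B) :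
    T ∘ₗ (∑ i ∈ s, T' i) = ∑ i ∈ s, T ∘ₗ T' i := by
  ext x; simp [LinearMap.sum_apply]

end LinearMapSums

/-! ### The operators q and u on the Grassmann algebra: q q = u u = 0 and u q + q u = 0 -/

section ExteriorOperators

attribute [local instance] LieRing.ofAssociativeRing

variable {g : Type*} [LieRing g] [LieAlgebra ℝ g]

/-- The interior product on the whole Grassmann algebra. -/
def interior (d : Module.Dual ℝ g) : Module.End ℝ (ExteriorAlgebra ℝ g) :=
  CliffordAlgebra.contractLeft (Q := (0 : QuadraticForm ℝ g)) d

theorem interior_ι_mul (d : Module.Dual ℝ g) (ξ : g) (x : ExteriorAlgebra ℝ g) :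
    interior d (ExteriorAlgebra.ι ℝ ξ * x) = d ξ • x - ExteriorAlgebra.ι ℝ ξ * interior d x :=
  CliffordAlgebra.contractLeft_ι_mul d ξ x

theorem interior_mul_interior (d d' : Module.Dual ℝ g) :
    interior d * interior d' = -(interior d' * interior d) :=
  LinearMap.ext fun x => CliffordAlgebra.contractLeft_comm d d' x

theorem interior_mul_cycle (d d' d'' : Module.Dual ℝ g) :
    interior d * (interior d' * interior d'') = interior d' * (interior d'' * interior d) := by
  have h : ∀ (d d' : Module.Dual ℝ g) x, interior d (interior d' x) = -interior d' (interior d x) :=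
    fun d d' x => CliffordAlgebra.contractLeft_comm d d' x
  refine LinearMap.ext fun x => ?_
  simp only [Module.End.mul_apply]
  rw [h d d', h d d'', map_neg, neg_neg]

/-- Exterior multiplication on the whole Grassmann algebra. -/
def exteriorMul (ξ : g) : Module.End ℝ (ExteriorAlgebra ℝ g) :=
  LinearMap.mulLeft ℝ (ExteriorAlgebra.ι ℝ ξ)

theorem exteriorMul_apply (ξ : g) (x : ExteriorAlgebra ℝ g) :
    exteriorMul ξ x = ExteriorAlgebra.ι ℝ ξ * x := rfl

theorem interior_mul_exteriorMul (d : Module.Dual ℝ g) (ξ : g) :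
    interior d * exteriorMul ξ = d ξ • 1 - exteriorMul ξ * interior d :=
  LinearMap.ext fun x => interior_ι_mul d ξ x

theorem coe_insertion (d : Module.Dual ℝ g) (i : ℕ) (x : ⋀[ℝ]^(i + 1) g) :
    (insertion d i x : ExteriorAlgebra ℝ g) = interior d x := rfl

theorem coe_wedge (ξ : g) (i : ℕ) (x : ⋀[ℝ]^i g) :
    (wedge ξ i x : ExteriorAlgebra ℝ g) = exteriorMul ξ x := rfl

theorem insertion_insertion (d d' : Module.Dual ℝ g) (i : ℕ) :
    insertion d i ∘ₗ insertion d' (i + 1) = -(insertion d' i ∘ₗ insertion d (i + 1)) :=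
  LinearMap.ext fun x => Subtype.ext (LinearMap.congr_fun (interior_mul_interior d d') x)

theorem insertion_wedge (d : Module.Dual ℝ g) (ξ : g) (i : ℕ) :
    insertion d (i + 1) ∘ₗ wedge ξ (i + 1) + wedge ξ i ∘ₗ insertion d i
      = d ξ • LinearMap.id := by
  refine LinearMap.ext fun x => Subtype.ext ?_
  have := interior_ι_mul d ξ (x : ExteriorAlgebra ℝ g)
  exact eq_sub_iff_add_eq.1 this

/-- The degree-zero case is separate because the second term of the anticommutator would be an
insertion on scalars, which has no target degree. -/
theorem insertion_wedge_zero (d : Module.Dual ℝ g) (ξ : g) :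
    insertion d 0 ∘ₗ wedge ξ 0 = d ξ • LinearMap.id := by
  refine LinearMap.ext fun x => Subtype.ext ?_
  refine (interior_ι_mul d ξ (x : ExteriorAlgebra ℝ g)).trans ?_
  obtain ⟨r, hr⟩ : ∃ r : ℝ, algebraMap ℝ _ r = (x : ExteriorAlgebra ℝ g) := by
    simpa [ExteriorAlgebra.exteriorPower] using x.2
  have h0 : interior d (x : ExteriorAlgebra ℝ g) = 0 := by
    rw [← hr]
    exact CliffordAlgebra.contractLeft_algebraMap _ d r
  rw [h0, mul_zero, sub_zero]
  rfl

variable {n : ℕ} (e : Module.Basis (Fin n) ℝ g)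

/-- Euler's identity for the degree operator on the Grassmann algebra. -/
theorem sum_exteriorMul_interior (i : ℕ) (x : ExteriorAlgebra ℝ g) (hx : x ∈ ⋀[ℝ]^i g) :
    ∑ c, exteriorMul (e c) (interior (e.coord c) x) = (i : ℝ) • x := by
  induction i generalizing x with
  | zero =>
    rw [ExteriorAlgebra.exteriorPower, pow_zero, Submodule.mem_one] at hx
    obtain ⟨r, rfl⟩ := hx
    have h0 : ∀ d : Module.Dual ℝ g, interior d (algebraMap ℝ (ExteriorAlgebra ℝ g) r) = 0 :=
      fun d => CliffordAlgebra.contractLeft_algebraMap _ d r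
    simp [h0]
  | succ i ih =>
    rw [ExteriorAlgebra.exteriorPower, pow_succ'] at hx
    induction hx using Submodule.mul_induction_on' with
    | mem_mul_mem a ha b hb =>
      obtain ⟨y, rfl⟩ := ha
      have hy : ∑ c, e.coord c y • ExteriorAlgebra.ι ℝ (e c) = ExteriorAlgebra.ι ℝ y := by
        conv_rhs => rw [← e.sum_repr y, map_sum]
        simp
      have hanti : ∀ ξ : g, ExteriorAlgebra.ι ℝ ξ * ExteriorAlgebra.ι ℝ y
          = -(ExteriorAlgebra.ι ℝ y * ExteriorAlgebra.ι ℝ ξ) := fun ξ =>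
        eq_neg_of_add_eq_zero_left (ExteriorAlgebra.ι_add_mul_swap ξ y)
      have key : ∀ c, exteriorMul (e c) (interior (e.coord c) (ExteriorAlgebra.ι ℝ y * b))
          = (e.coord c y • ExteriorAlgebra.ι ℝ (e c)) * b
            + ExteriorAlgebra.ι ℝ y * exteriorMul (e c) (interior (e.coord c) b) := by
        intro c
        rw [interior_ι_mul, map_sub, map_smul, exteriorMul_apply, exteriorMul_apply,
          exteriorMul_apply, ← mul_assoc, hanti]
        simp only [neg_mul, sub_neg_eq_add, smul_mul_assoc, mul_assoc]
      refine (Finset.sum_congr rfl fun c _ => key c).trans ?_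
      rw [Finset.sum_add_distrib, ← Finset.sum_mul, hy, ← Finset.mul_sum, ih b hb]
      push_cast
      rw [add_smul, one_smul, mul_smul_comm, add_comm]
    | add a _ b _ ha hb =>
      simp only [map_add, Finset.sum_add_distrib, smul_add] at ha hb ⊢
      rw [ha, hb]

/-- Euler's identity expresses (i + 1) x through the contractions of x, and i + 1 is invertible.
This allows induction on the degree by contracting. -/
theorem eq_zero_of_interior_eq_zero (i : ℕ) (x : ExteriorAlgebra ℝ g) (hx : x ∈ ⋀[ℝ]^(i + 1) g)
    (h : ∀ c, interior (e.coord c) x = 0) : x = 0 := by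
  have := sum_exteriorMul_interior e (i + 1) x hx
  simp only [h, map_zero, Finset.sum_const_zero] at this
  exact (smul_eq_zero.1 this.symm).resolve_left (by positivity)

theorem structureConst_antisymm (c a b : Fin n) :
    structureConst e c a b = -structureConst e c b a := by
  rw [structureConst, structureConst, ← lie_skew, map_neg]

theorem lie_eq_sum_structureConst (a b : Fin n) :
    ⁅e a, e b⁆ = ∑ c, structureConst e c a b • e c := (e.sum_repr _).symm

theorem sum_structureConst_mul (c a d f : Fin n) :
    ∑ b, structureConst e c a b * structureConst e b d f = e.coord c ⁅e a, ⁅e d, e f⁆⁆ := by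
  rw [lie_eq_sum_structureConst e d f, lie_sum, map_sum]
  refine Finset.sum_congr rfl fun b _ => ?_
  rw [lie_smul, map_smul, smul_eq_mul, mul_comm]
  rfl

/-- The Chevalley-Eilenberg boundary operator on the whole Grassmann algebra. -/
def ceBoundary : Module.End ℝ (ExteriorAlgebra ℝ g) :=
  (-(1 / 2) : ℝ) • ∑ a, ∑ b, ∑ c, structureConst e c a b •
      (exteriorMul (e c) * (interior (e.coord a) * interior (e.coord b)))

/-- The anticommutator of an interior product with the Chevalley-Eilenberg boundary operator. -/
def ceCurvature (c : Fin n) : Module.End ℝ (ExteriorAlgebra ℝ g) :=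
  (-(1 / 2) : ℝ) • ∑ a, ∑ b, structureConst e c a b •
    (interior (e.coord a) * interior (e.coord b))

/-- In degree one `qOp` is zero by definition; this agrees with the formula because two contractions
kill vectors. -/
theorem coe_qOp (i : ℕ) (x : ⋀[ℝ]^(i + 1) g) :
    (qOp e i x : ExteriorAlgebra ℝ g) = ceBoundary e x := by
  cases i with
  | zero =>
    have h : ∀ a b, interior (e.coord a) (interior (e.coord b) (x : ExteriorAlgebra ℝ g)) = 0 := by
      intro a b
      have hx := contractLeft_mem (e.coord b) 0 x.1 x.2
      rw [ExteriorAlgebra.exteriorPower, pow_zero, Submodule.mem_one] at hx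
      obtain ⟨r, hr⟩ := hx
      rw [interior, interior, ← hr]
      exact CliffordAlgebra.contractLeft_algebraMap _ _ r
    simp [qOp, ceBoundary, LinearMap.sum_apply, h]
  | succ i =>
    simp only [qOp, ceBoundary, LinearMap.smul_apply, LinearMap.sum_apply, Submodule.coe_smul,
      Submodule.coe_sum, LinearMap.comp_apply, Module.End.mul_apply, coe_wedge, coe_insertion]

/-- A contraction passes the two contractions in q without sign and anticommutes with exterior
multiplication up to a scalar, so only that Kronecker delta survives. -/
theorem interior_ceBoundary (d : Fin n) :
    interior (e.coord d) * ceBoundary e + ceBoundary e * interior (e.coord d)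
      = ceCurvature e d := by
  simp only [ceBoundary, ceCurvature, mul_smul_comm, smul_mul_assoc, Finset.mul_sum,
    Finset.sum_mul]
  rw [← smul_add]
  congr 1
  simp only [← Finset.sum_add_distrib]
  refine Finset.sum_congr rfl fun a _ => Finset.sum_congr rfl fun b _ => ?_
  have key : ∀ c, structureConst e c a b •
        (interior (e.coord d) * (exteriorMul (e c) * (interior (e.coord a) * interior (e.coord b))))
      + structureConst e c a b •
        (exteriorMul (e c) * (interior (e.coord a) * interior (e.coord b)) * interior (e.coord d))
      = structureConst e c a b • e.coord d (e c) •
          (interior (e.coord a) * interior (e.coord b)) := by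
    intro c
    rw [← smul_add]
    congr 1
    have h3 : interior (e.coord a) * interior (e.coord b) * interior (e.coord d)
        = interior (e.coord d) * (interior (e.coord a) * interior (e.coord b)) := by
      rw [mul_assoc, interior_mul_cycle, interior_mul_cycle]
    rw [← mul_assoc (interior (e.coord d)), interior_mul_exteriorMul, mul_assoc (exteriorMul _),
      h3, sub_mul, smul_mul_assoc, one_mul, mul_assoc, sub_add_cancel]
  simp only [key]
  rw [Finset.sum_eq_single d]
  · simp
  · intro c _ hc
    simp [Finsupp.single_eq_of_ne hc.symm]
  · simp

theorem interior_comm_ceCurvature (a b : Fin n) :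
    interior (e.coord a) * ceCurvature e b = ceCurvature e b * interior (e.coord a) := by
  simp only [ceCurvature, mul_smul_comm, smul_mul_assoc, Finset.mul_sum, Finset.sum_mul]
  congr 1
  refine Finset.sum_congr rfl fun d _ => Finset.sum_congr rfl fun f _ => ?_
  rw [mul_assoc, interior_mul_cycle]

/-- The Jacobi identity: the coefficients become components of [e_a, [e_d, e_f]], and the product of
three contractions is cyclically invariant, so three times the sum carries the cyclic sum of double
brackets. -/
theorem sum_interior_ceCurvature (c : Fin n) :
    ∑ a, ∑ b, structureConst e c a b • (interior (e.coord a) * ceCurvature e b) = 0 := by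
  let K : Fin n → Fin n → Fin n → Module.End ℝ (ExteriorAlgebra ℝ g) := fun a d f =>
    interior (e.coord a) * (interior (e.coord d) * interior (e.coord f))
  have hcyc : ∀ a d f, K a d f = K d f a := fun a d f => interior_mul_cycle _ _ _
  let L : Fin n → Fin n → Fin n → ℝ := fun a d f => e.coord c ⁅e a, ⁅e d, e f⁆⁆
  have hL : ∀ a d f, L a d f + L d f a + L f a d = 0 := by
    intro a d f
    simp only [L]
    rw [← map_add, ← map_add, lie_jacobi, map_zero]
  have hsum : ∑ a, ∑ b, structureConst e c a b • (interior (e.coord a) * ceCurvature e b)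
      = (-(1 / 2) : ℝ) • ∑ a, ∑ d, ∑ f, L a d f • K a d f := by
    simp only [ceCurvature, mul_smul_comm, Finset.mul_sum, Finset.smul_sum]
    refine Finset.sum_congr rfl fun a _ => ?_
    rw [Finset.sum_comm]
    refine Finset.sum_congr rfl fun d _ => ?_
    rw [Finset.sum_comm]
    refine Finset.sum_congr rfl fun f _ => ?_
    simp only [L]
    rw [← sum_structureConst_mul, Finset.sum_smul, Finset.smul_sum]
    refine Finset.sum_congr rfl fun b _ => ?_
    simp only [smul_smul, K]
    congr 1
    ring
  have hperm : ∀ G : Fin n → Fin n → Fin n → Module.End ℝ (ExteriorAlgebra ℝ g),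
      ∑ a, ∑ d, ∑ f, G d f a = ∑ a, ∑ d, ∑ f, G a d f := by
    intro G
    rw [Finset.sum_comm]
    exact Finset.sum_congr rfl fun d _ => Finset.sum_comm
  have h1 : ∑ a, ∑ d, ∑ f, L a d f • K a d f = ∑ a, ∑ d, ∑ f, L d f a • K a d f := by
    rw [← hperm fun a d f => L a d f • K a d f]
    simp only [← hcyc]
  have h2 : ∑ a, ∑ d, ∑ f, L a d f • K a d f = ∑ a, ∑ d, ∑ f, L f a d • K a d f := by
    rw [← hperm fun a d f => L a d f • K a d f, ← hperm fun a d f => L d f a • K d f a]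
    refine Finset.sum_congr rfl fun a _ => Finset.sum_congr rfl fun d _ =>
      Finset.sum_congr rfl fun f _ => ?_
    rw [hcyc f a d]
  have h3 : (3 : ℝ) • ∑ a, ∑ d, ∑ f, L a d f • K a d f = 0 := by
    calc (3 : ℝ) • ∑ a, ∑ d, ∑ f, L a d f • K a d f
        = ∑ a, ∑ d, ∑ f, L a d f • K a d f + ∑ a, ∑ d, ∑ f, L a d f • K a d f
          + ∑ a, ∑ d, ∑ f, L a d f • K a d f := by module
      _ = ∑ a, ∑ d, ∑ f, (L a d f + L d f a + L f a d) • K a d f := by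
          refine (congrArg₂ (· + ·) (congrArg (_ + ·) h1) h2).trans ?_
          simp only [add_smul, Finset.sum_add_distrib]
      _ = 0 := by simp [hL]
  rw [hsum, (smul_eq_zero.1 h3).resolve_left (by norm_num), smul_zero]

/-- Moving q through two contractions costs two terms of the form contraction times curvature.
Weighted by the structure constants, each sums to zero by `sum_interior_ceCurvature`. -/
theorem ceCurvature_comm_ceBoundary (c : Fin n) :
    ceCurvature e c * ceBoundary e = ceBoundary e * ceCurvature e c := by
  have hq : ∀ a, interior (e.coord a) * ceBoundary e
      = ceCurvature e a - ceBoundary e * interior (e.coord a) := fun a =>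
    eq_sub_of_add_eq (interior_ceBoundary e a)
  have key : ∀ a b, interior (e.coord a) * interior (e.coord b) * ceBoundary e
      = ceBoundary e * (interior (e.coord a) * interior (e.coord b))
        + (interior (e.coord a) * ceCurvature e b - interior (e.coord b) * ceCurvature e a) := by
    intro a b
    rw [mul_assoc, hq, mul_sub, ← mul_assoc (interior (e.coord a)), hq,
      interior_comm_ceCurvature e b a, sub_mul, mul_assoc (ceBoundary e)]
    abel
  have h2 : ∑ a, ∑ b, structureConst e c a b • (interior (e.coord b) * ceCurvature e a) = 0 := by
    rw [Finset.sum_comm, ← neg_eq_zero, ← sum_interior_ceCurvature e c]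
    simp only [← Finset.sum_neg_distrib]
    refine Finset.sum_congr rfl fun b _ => Finset.sum_congr rfl fun a _ => ?_
    rw [structureConst_antisymm e c b a]
    exact (neg_smul _ _).symm
  conv_lhs => rw [ceCurvature]
  conv_rhs => rw [ceCurvature]
  simp only [mul_smul_comm, smul_mul_assoc, Finset.mul_sum, Finset.sum_mul, key, smul_add,
    smul_sub, Finset.sum_add_distrib, Finset.sum_sub_distrib]
  rw [h2]
  rw [sum_interior_ceCurvature e c]
  simp

theorem interior_comm_ceBoundary_sq (c : Fin n) :
    interior (e.coord c) * (ceBoundary e * ceBoundary e)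
      = ceBoundary e * ceBoundary e * interior (e.coord c) := by
  have hq : interior (e.coord c) * ceBoundary e
      = ceCurvature e c - ceBoundary e * interior (e.coord c) :=
    eq_sub_of_add_eq (interior_ceBoundary e c)
  rw [← mul_assoc, hq, sub_mul, mul_assoc (ceBoundary e), hq, ceCurvature_comm_ceBoundary,
    mul_sub, mul_assoc]
  abel

/-- Contractions commute with q q, so by induction on the degree every contraction of q q x
vanishes. In the lowest degree the outer q is zero by definition. -/
theorem qOp_comp_qOp (i : ℕ) : qOp e i ∘ₗ qOp e (i + 1) = 0 := by
  induction i with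
  | zero => rfl
  | succ i ih =>
    refine LinearMap.ext fun x => Subtype.ext ?_
    refine eq_zero_of_interior_eq_zero e i _ (Subtype.property _) fun c => ?_
    have h := LinearMap.congr_fun (interior_comm_ceBoundary_sq e c) (x : ExteriorAlgebra ℝ g)
    have h' := congrArg Subtype.val (LinearMap.congr_fun ih (insertion (e.coord c) _ x))
    simp only [LinearMap.comp_apply, coe_qOp, coe_insertion, Module.End.mul_apply] at h h' ⊢
    rw [h, h']
    rfl

theorem insertion_qOp (c : Fin n) (i : ℕ) :
    insertion (e.coord c) i ∘ₗ qOp e (i + 1) + qOp e i ∘ₗ insertion (e.coord c) (i + 1)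
      = (-(1 / 2) : ℝ) • ∑ a, ∑ b, structureConst e c a b •
        (insertion (e.coord a) i ∘ₗ insertion (e.coord b) (i + 1)) := by
  refine LinearMap.ext fun x => Subtype.ext ?_
  have h := LinearMap.congr_fun (interior_ceBoundary e c) (x : ExteriorAlgebra ℝ g)
  simpa [ceCurvature, coe_qOp, coe_insertion, LinearMap.sum_apply] using h

theorem uOp_eq_sum (i : ℕ) : uOp g i = ∑ c, LinearMap.trace ℝ g (LieAlgebra.ad ℝ g (e c)) •
    insertion (e.coord c) i := by
  have h : (LinearMap.trace ℝ g ∘ₗ (LieAlgebra.ad ℝ g).toLinearMap : Module.Dual ℝ g)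
      = ∑ c, LinearMap.trace ℝ g (LieAlgebra.ad ℝ g (e c)) • e.coord c := by
    refine e.ext fun b => ?_
    simp [LinearMap.sum_apply, Finsupp.single_apply]
  refine LinearMap.ext fun x => Subtype.ext ?_
  rw [uOp, h, coe_insertion]
  have : ∀ s : Finset (Fin n),
      interior (∑ c ∈ s, LinearMap.trace ℝ g (LieAlgebra.ad ℝ g (e c)) • e.coord c)
      = ∑ c ∈ s, LinearMap.trace ℝ g (LieAlgebra.ad ℝ g (e c)) • interior (e.coord c) := by
    intro s
    exact (map_sum _ _ _).trans (Finset.sum_congr rfl fun c _ => map_smul _ _ _)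
  rw [this]
  simp [LinearMap.sum_apply, coe_insertion]

theorem uOp_comp_uOp (i : ℕ) : uOp g i ∘ₗ uOp g (i + 1) = 0 := by
  refine LinearMap.ext fun x => Subtype.ext ?_
  exact CliffordAlgebra.contractLeft_contractLeft _ _

theorem insertion_uOp (d : Module.Dual ℝ g) (i : ℕ) :
    insertion d i ∘ₗ uOp g (i + 1) + uOp g i ∘ₗ insertion d (i + 1) = 0 := by
  refine LinearMap.ext fun x => Subtype.ext ?_
  exact eq_neg_iff_add_eq_zero.1 (CliffordAlgebra.contractLeft_comm d _ (x : ExteriorAlgebra ℝ g))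

/-- By `insertion_qOp` the anticommutator has coefficients proportional to tr ad [e_a, e_b], the
trace of a commutator. -/
theorem uOp_qOp (i : ℕ) : uOp g i ∘ₗ qOp e (i + 1) + qOp e i ∘ₗ uOp g (i + 1) = 0 := by
  have htr : ∀ a b, ∑ c, LinearMap.trace ℝ g (LieAlgebra.ad ℝ g (e c)) * structureConst e c a b
      = 0 := by
    intro a b
    have h : LinearMap.trace ℝ g (LieAlgebra.ad ℝ g ⁅e a, e b⁆) = 0 := by
      rw [LieHom.map_lie, LieRing.of_associative_ring_bracket, map_sub, LinearMap.trace_mul_comm,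
        sub_self]
    rw [lie_eq_sum_structureConst, map_sum, map_sum] at h
    rw [← h]
    refine Finset.sum_congr rfl fun c _ => ?_
    rw [map_smul, map_smul, smul_eq_mul, mul_comm]
  rw [uOp_eq_sum e, uOp_eq_sum e, sum_linearMap_comp, linearMap_comp_sum,
    ← Finset.sum_add_distrib]
  have h1 : ∀ c, (LinearMap.trace ℝ g (LieAlgebra.ad ℝ g (e c)) • insertion (e.coord c) i) ∘ₗ
        qOp e (i + 1)
      + qOp e i ∘ₗ (LinearMap.trace ℝ g (LieAlgebra.ad ℝ g (e c)) • insertion (e.coord c) (i + 1))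
      = (-(1 / 2) : ℝ) • ∑ a, ∑ b, (LinearMap.trace ℝ g (LieAlgebra.ad ℝ g (e c))
        * structureConst e c a b) • (insertion (e.coord a) i ∘ₗ insertion (e.coord b) (i + 1)) := by
    intro c
    rw [LinearMap.smul_comp, LinearMap.comp_smul, ← smul_add, insertion_qOp, smul_comm]
    simp only [Finset.smul_sum, smul_smul]
  simp only [h1]
  rw [← Finset.smul_sum, Finset.sum_comm]
  have h2 : ∀ a, ∑ c, ∑ b, (LinearMap.trace ℝ g (LieAlgebra.ad ℝ g (e c))
        * structureConst e c a b) • (insertion (e.coord a) i ∘ₗ insertion (e.coord b) (i + 1))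
      = 0 := by
    intro a
    rw [Finset.sum_comm]
    refine Finset.sum_eq_zero fun b _ => ?_
    rw [← Finset.sum_smul, htr, zero_smul]
  simp [h2]

end ExteriorOperators

/-! ### Bookkeeping for tensor products of complex and real linear maps -/

section TensorMaps

variable {A B C V W U ι : Type*}
    [AddCommGroup A] [Module ℝ A] [Module ℂ A] [IsScalarTower ℝ ℂ A]
    [AddCommGroup B] [Module ℝ B] [Module ℂ B] [IsScalarTower ℝ ℂ B]
    [AddCommGroup C] [Module ℝ C] [Module ℂ C] [IsScalarTower ℝ ℂ C]
    [AddCommGroup V] [Module ℝ V] [AddCommGroup W] [Module ℝ W] [AddCommGroup U] [Module ℝ U]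

/-- The tensor product of a complex linear map and a real linear map. -/
abbrev tmap (T : A →ₗ[ℂ] B) (X : V →ₗ[ℝ] W) : A ⊗[ℝ] V →ₗ[ℂ] B ⊗[ℝ] W :=
  TensorProduct.AlgebraTensorModule.map T X

theorem tmap_comp_tmap (T : B →ₗ[ℂ] C) (T' : A →ₗ[ℂ] B) (X : W →ₗ[ℝ] U) (X' : V →ₗ[ℝ] W) :
    tmap T X ∘ₗ tmap T' X' = tmap (T ∘ₗ T') (X ∘ₗ X') :=
  (TensorProduct.AlgebraTensorModule.map_comp _ _ _ _).symm

theorem tmap_sum_left (s : Finset ι) (T : ι → A →ₗ[ℂ] B) (X : V →ₗ[ℝ] W) :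
    tmap (∑ i ∈ s, T i) X = ∑ i ∈ s, tmap (T i) X := by
  classical
  induction s using Finset.induction_on with
  | empty => ext; simp
  | insert a s ha ih =>
    rw [Finset.sum_insert ha, Finset.sum_insert ha, ← ih]
    exact TensorProduct.AlgebraTensorModule.map_add_left _ _ _

theorem tmap_sum_right (s : Finset ι) (T : A →ₗ[ℂ] B) (X : ι → V →ₗ[ℝ] W) :
    tmap T (∑ i ∈ s, X i) = ∑ i ∈ s, tmap T (X i) := by
  classical
  induction s using Finset.induction_on with
  | empty => ext; simp
  | insert a s ha ih =>
    rw [Finset.sum_insert ha, Finset.sum_insert ha, ← ih]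
    exact TensorProduct.AlgebraTensorModule.map_add_right _ _ _

theorem tmap_sub_left (T T' : A →ₗ[ℂ] B) (X : V →ₗ[ℝ] W) :
    tmap (T - T') X = tmap T X - tmap T' X := by
  ext; simp [TensorProduct.sub_tmul]

theorem tmap_neg_right (T : A →ₗ[ℂ] B) (X : V →ₗ[ℝ] W) :
    tmap T (-X) = -tmap T X := by
  ext; simp [TensorProduct.tmul_neg]

theorem tmap_add_right (T : A →ₗ[ℂ] B) (X X' : V →ₗ[ℝ] W) :
    tmap T (X + X') = tmap T X + tmap T X' :=
  TensorProduct.AlgebraTensorModule.map_add_right _ _ _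

theorem tmap_smul_left (z : ℂ) (T : A →ₗ[ℂ] B) (X : V →ₗ[ℝ] W) :
    tmap (z • T) X = z • tmap T X :=
  TensorProduct.AlgebraTensorModule.map_smul_left _ _ _

theorem tmap_smul_right (r : ℝ) (T : A →ₗ[ℂ] B) (X : V →ₗ[ℝ] W) :
    tmap T (r • X) = (r : ℂ) • tmap T X := by
  ext x y
  simp only [tmap, TensorProduct.AlgebraTensorModule.curry_apply, LinearMap.coe_restrictScalars,
    TensorProduct.curry_apply, TensorProduct.AlgebraTensorModule.map_tmul, LinearMap.smul_apply,
    TensorProduct.tmul_smul]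
  exact (algebraMap_smul ℂ r _).symm

theorem tmap_add_left (T T' : A →ₗ[ℂ] B) (X : V →ₗ[ℝ] W) :
    tmap (T + T') X = tmap T X + tmap T' X :=
  TensorProduct.AlgebraTensorModule.map_add_left _ _ _

theorem tmap_id_id : tmap (LinearMap.id : A →ₗ[ℂ] A) (LinearMap.id : V →ₗ[ℝ] V) = LinearMap.id :=
  TensorProduct.AlgebraTensorModule.map_id

theorem tmap_zero_right (T : A →ₗ[ℂ] B) : tmap T (0 : V →ₗ[ℝ] W) = 0 := by
  ext; simp

end TensorMaps

/-! ### The quantised Koszul operator squares to zero -/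

section QuantumBoundary

variable {m : ℕ} {M : Type*} [TopologicalSpace M] [ChartedSpace (EuclideanSpace ℝ (Fin m)) M]
  {g : Type*} [LieRing g] [LieAlgebra ℝ g]

theorem rightMul_apply (C : ℕ → smoothFun m M →ₗ[ℂ] smoothFun m M →ₗ[ℂ] smoothFun m M)
    (G : Formal (smoothFun m M)) (r : ℕ) (F : smoothFun m M) :
    rightMul C G r F = ∑ st ∈ Finset.HasAntidiagonal.antidiagonal r, C st.1 F (G.coeff st.2) := by
  simp [rightMul, LinearMap.sum_apply]

theorem rightMul_sub (C : ℕ → smoothFun m M →ₗ[ℂ] smoothFun m M →ₗ[ℂ] smoothFun m M)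
    (G G' : Formal (smoothFun m M)) (r : ℕ) :
    rightMul C (G - G') r = rightMul C G r - rightMul C G' r := by
  ext1 F
  simp [rightMul_apply]

variable {P : PoissonStructure m M} {S : StarProduct P}

/-- Associativity of the star product, read coefficient by coefficient. Composition of right
multiplications reverses the order of the factors, which is the source of the minus sign in
`momentumMulMul_sub_succ`. -/
theorem rightMul_comp_rightMul (S : StarProduct P) (G G' : Formal (smoothFun m M)) (r : ℕ) :
    ∑ st ∈ Finset.HasAntidiagonal.antidiagonal r, rightMul S.C G st.1 ∘ₗ rightMul S.C G' st.2
      = rightMul S.C (starMul S.C G' G) r := by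
  have h : Formal.opSeries (rightMul S.C G) ∘ₗ Formal.opSeries (rightMul S.C G')
      = Formal.opSeries (rightMul S.C (starMul S.C G' G)) := by
    refine LinearMap.ext fun F => ?_
    rw [LinearMap.comp_apply, opSeries_rightMul, opSeries_rightMul, opSeries_rightMul, S.assoc]
  rw [Formal.opSeries_comp] at h
  exact congrFun (Formal.opSeries_injective h) r

theorem I_smul_X_smul_coeff_zero (G : Formal (smoothFun m M)) :
    ((Complex.I • (PowerSeries.X : ℂ⟦X⟧)) • G).coeff 0 = 0 := by
  simp [Formal.coeff_smul]

theorem I_smul_X_smul_coeff_succ (G : Formal (smoothFun m M)) (k : ℕ) :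
    ((Complex.I • (PowerSeries.X : ℂ⟦X⟧)) • G).coeff (k + 1) = Complex.I • G.coeff k := by
  rw [Formal.coeff_smul, Finset.sum_eq_single (1, k)]
  · simp
  · rintro ⟨a, b⟩ h hne
    have ha : a ≠ 1 := by
      rintro rfl
      simp only [Finset.HasAntidiagonal.mem_antidiagonal] at h
      exact hne (by rw [show b = k by omega])
    simp [PowerSeries.coeff_X, ha]
  · intro h
    exact absurd (by simp [add_comm]) h

variable {n : ℕ} (e : Module.Basis (Fin n) ℝ g)

theorem pairing_lie (J : M → Module.Dual ℝ g) (hJ : IsSmoothMap m J) (a b : Fin n) :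
    pairing J hJ ⁅e a, e b⁆ = ∑ c, (structureConst e c a b : ℂ) • pairing J hJ (e c) := by
  refine Subtype.ext (funext fun x => ?_)
  rw [AddSubmonoidClass.coe_finsetSum, Finset.sum_apply]
  simp only [pairing, lie_eq_sum_structureConst, map_sum, map_smul, smul_eq_mul]
  push_cast
  rfl

variable (Q : QuantumMomentumMap S g)

/-- The `lam ^ r` coefficient of the right star multiplication by the component `J_a` of the
quantum momentum map. -/
abbrev momentumMul (a : Fin n) (r : ℕ) : smoothFun m M →ₗ[ℂ] smoothFun m M :=
  rightMul S.C (pairingSeries Q.J Q.smooth (e a)) r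

/-- The `lam ^ r` coefficient of the composition of two right star multiplications. -/
abbrev momentumMulMul (a b : Fin n) (r : ℕ) : smoothFun m M →ₗ[ℂ] smoothFun m M :=
  ∑ st ∈ Finset.HasAntidiagonal.antidiagonal r, momentumMul e Q a st.1 ∘ₗ momentumMul e Q b st.2

theorem momentumMulMul_sub (a b : Fin n) (r : ℕ) :
    momentumMulMul e Q a b r - momentumMulMul e Q b a r
      = rightMul S.C ((Complex.I • (PowerSeries.X : ℂ⟦X⟧)) •
          pairingSeries Q.J Q.smooth ⁅e b, e a⁆) r := by
  rw [momentumMulMul, momentumMulMul, rightMul_comp_rightMul, rightMul_comp_rightMul,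
    ← Q.covariant, rightMul_sub]

theorem momentumMulMul_sub_zero (a b : Fin n) :
    momentumMulMul e Q a b 0 - momentumMulMul e Q b a 0 = 0 := by
  rw [momentumMulMul_sub]
  ext1 F
  simp [rightMul_apply, I_smul_X_smul_coeff_zero]

theorem momentumMulMul_sub_succ (a b : Fin n) (k : ℕ) :
    momentumMulMul e Q a b (k + 1) - momentumMulMul e Q b a (k + 1)
      = (-Complex.I) • ∑ c, (structureConst e c a b : ℂ) • momentumMul e Q c k := by
  rw [momentumMulMul_sub]
  refine LinearMap.ext fun F => ?_
  -- The split isolates the coefficient of order zero of the multiplier, which vanishes because of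
  -- its factor lambda; the rest is shifted down by one order.
  rw [rightMul_apply, Finset.Nat.antidiagonal_succ']
  rw [Finset.sum_cons, I_smul_X_smul_coeff_zero, map_zero, zero_add, Finset.sum_map]
  simp only [Function.Embedding.prodMap, Function.Embedding.coeFn_mk, Prod.map_fst, Prod.map_snd,
    Function.Embedding.refl_apply, Nat.succ_eq_add_one, I_smul_X_smul_coeff_succ, map_smul,
    LinearMap.smul_apply, LinearMap.sum_apply, rightMul_apply]
  rw [← Finset.smul_sum, neg_smul, ← smul_neg]
  congr 1
  simp only [Finset.smul_sum]
  rw [Finset.sum_comm, ← Finset.sum_neg_distrib]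
  refine Finset.sum_congr rfl fun st _ => ?_
  simp only [pairingSeries, pairing_lie, map_sum, map_smul]
  rw [← Finset.sum_neg_distrib]
  refine Finset.sum_congr rfl fun c _ => ?_
  rw [structureConst_antisymm]
  simp

/-- The order `lam` correction `(1/2) u - q` of the quantised Koszul operator, up to the factor
`i`. -/
abbrev modularTerm (i : ℕ) : ⋀[ℝ]^(i + 1) g →ₗ[ℝ] ⋀[ℝ]^i g := (1 / 2 : ℝ) • uOp g i - qOp e i

theorem modularTerm_comp (i : ℕ) : modularTerm e i ∘ₗ modularTerm e (i + 1) = 0 := by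
  have h1 : ∀ x, uOp g i (uOp g (i + 1) x) = 0 := LinearMap.congr_fun (uOp_comp_uOp (g := g) i)
  have h2 : ∀ x, qOp e i (qOp e (i + 1) x) = 0 := LinearMap.congr_fun (qOp_comp_qOp e i)
  have h3 : ∀ x, uOp g i (qOp e (i + 1) x) + qOp e i (uOp g (i + 1) x) = 0 :=
    LinearMap.congr_fun (uOp_qOp e i)
  refine LinearMap.ext fun x => ?_
  simp only [modularTerm, LinearMap.comp_apply, LinearMap.sub_apply, LinearMap.smul_apply, map_sub,
    map_smul, h1, h2, LinearMap.zero_apply]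
  rw [eq_neg_of_add_eq_zero_left (h3 x)]
  module

theorem insertion_modularTerm (c : Fin n) (i : ℕ) :
    insertion (e.coord c) i ∘ₗ modularTerm e (i + 1) + modularTerm e i ∘ₗ insertion (e.coord c) (i + 1)
      = (1 / 2 : ℝ) • ∑ a, ∑ b, structureConst e c a b •
        (insertion (e.coord a) i ∘ₗ insertion (e.coord b) (i + 1)) := by
  have h1 := insertion_qOp e c i
  have h2 := insertion_uOp (e.coord c) i
  refine LinearMap.ext fun x => ?_
  have h1 := LinearMap.congr_fun h1 x
  have h2 := LinearMap.congr_fun h2 x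
  simp only [modularTerm, LinearMap.comp_apply, LinearMap.add_apply, LinearMap.sub_apply,
    LinearMap.smul_apply, map_sub, map_smul, LinearMap.zero_apply] at h1 h2 ⊢
  rw [eq_neg_of_add_eq_zero_left h2, neg_smul] at *
  rw [← neg_eq_iff_eq_neg] at h1
  rw [← h1]
  module

/-- The part of the coefficients of the quantised Koszul operator coming from the momentum map. -/
abbrev momentumPart (i r : ℕ) : KoszulSpace m M g (i + 1) →ₗ[ℂ] KoszulSpace m M g i :=
  ∑ a, tmap (momentumMul e Q a r) (insertion (e.coord a) i)

/-- The part of the quantised Koszul operator coming from the Lie algebra structure. -/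
abbrev modularPart (m : ℕ) (M : Type*) [TopologicalSpace M]
    [ChartedSpace (EuclideanSpace ℝ (Fin m)) M] (i : ℕ) :
    KoszulSpace m M g (i + 1) →ₗ[ℂ] KoszulSpace m M g i :=
  Complex.I • tmap LinearMap.id (modularTerm e i)

/-- The composition of two insertions. -/
abbrev insertionInsertion (i : ℕ) (a b : Fin n) : ⋀[ℝ]^(i + 1 + 1) g →ₗ[ℝ] ⋀[ℝ]^i g :=
  insertion (e.coord a) i ∘ₗ insertion (e.coord b) (i + 1)

theorem modularPart_comp (i : ℕ) : modularPart e m M i ∘ₗ modularPart e m M (i + 1) = 0 := by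
  rw [modularPart, modularPart, LinearMap.smul_comp, LinearMap.comp_smul, tmap_comp_tmap,
    modularTerm_comp, tmap_zero_right, smul_zero, smul_zero]

theorem sum_momentumPart_comp (i N : ℕ) :
    ∑ rs ∈ Finset.HasAntidiagonal.antidiagonal N,
        momentumPart e Q i rs.1 ∘ₗ momentumPart e Q (i + 1) rs.2
      = ∑ a, ∑ b, tmap (momentumMulMul e Q a b N) (insertionInsertion e i a b) := by
  simp only [sum_linearMap_comp, linearMap_comp_sum, tmap_comp_tmap, tmap_sum_left]
  rw [Finset.sum_comm]
  conv_rhs => rw [Finset.sum_comm]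
  exact Finset.sum_congr rfl fun a _ => Finset.sum_comm

/-- Swapping a and b changes the sign of the two insertions, so only the commutator of the
multiplications contributes. -/
theorem two_smul_sum_momentumPart_comp (i N : ℕ) :
    (2 : ℂ) • ∑ a, ∑ b, tmap (momentumMulMul e Q a b N) (insertionInsertion e i a b)
      = ∑ a, ∑ b, tmap (momentumMulMul e Q a b N - momentumMulMul e Q b a N)
        (insertionInsertion e i a b) := by
  simp only [tmap_sub_left, Finset.sum_sub_distrib]
  rw [two_smul, sub_eq_add_neg]
  congr 1
  rw [Finset.sum_comm, ← Finset.sum_neg_distrib]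
  refine Finset.sum_congr rfl fun a _ => ?_
  rw [← Finset.sum_neg_distrib]
  refine Finset.sum_congr rfl fun b _ => ?_
  rw [insertionInsertion, insertion_insertion, tmap_neg_right]

/-- The common value, up to sign, of the two contributions to the square of the quantised Koszul
operator. -/
abbrev curvatureTerm (i k : ℕ) : KoszulSpace m M g (i + 1 + 1) →ₗ[ℂ] KoszulSpace m M g i :=
  ∑ a, ∑ b, ∑ c, (Complex.I * structureConst e c a b) •
    tmap (momentumMul e Q c k) (insertionInsertion e i a b)

/-- The two parts act on different tensor factors, so only the anticommutator of insertions with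
(1/2) u - q matters; u contributes nothing to it. -/
theorem momentumPart_modularPart (i k : ℕ) :
    momentumPart e Q i k ∘ₗ modularPart e m M (i + 1)
        + modularPart e m M i ∘ₗ momentumPart e Q (i + 1) k
      = (1 / 2 : ℂ) • curvatureTerm e Q i k := by
  simp only [sum_linearMap_comp, linearMap_comp_sum, LinearMap.smul_comp,
    LinearMap.comp_smul, tmap_comp_tmap, LinearMap.id_comp, LinearMap.comp_id]
  rw [Finset.smul_sum, ← Finset.sum_add_distrib]
  simp only [← smul_add, ← tmap_add_right, insertion_modularTerm, tmap_smul_right,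
    tmap_sum_right]
  have h : ∀ c : Fin n, Complex.I • ((1 / 2 : ℝ) : ℂ) • ∑ a, ∑ b,
        (structureConst e c a b : ℂ) •
          tmap (momentumMul e Q c k) (insertionInsertion e i a b)
      = (1 / 2 : ℂ) • ∑ a, ∑ b, (Complex.I * structureConst e c a b) •
        tmap (momentumMul e Q c k) (insertionInsertion e i a b) := by
    intro c
    rw [smul_comm]
    push_cast
    simp only [Finset.smul_sum, mul_smul]
  refine (Finset.sum_congr rfl fun c _ => h c).trans ?_
  rw [← Finset.smul_sum, Finset.sum_comm]
  exact congrArg ((1 / 2 : ℂ) • ·) (Finset.sum_congr rfl fun a _ => Finset.sum_comm)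

theorem sum_momentumPart_comp_zero (i : ℕ) :
    ∑ a, ∑ b, tmap (momentumMulMul e Q a b 0) (insertionInsertion e i a b) = 0 := by
  refine (smul_eq_zero.1 ((two_smul_sum_momentumPart_comp e Q i 0).trans ?_)).resolve_left
    two_ne_zero
  refine Finset.sum_eq_zero fun a _ => Finset.sum_eq_zero fun b _ => ?_
  rw [momentumMulMul_sub_zero]
  ext; simp

theorem sum_momentumPart_comp_succ (i k : ℕ) :
    ∑ a, ∑ b, tmap (momentumMulMul e Q a b (k + 1)) (insertionInsertion e i a b)
      = -((1 / 2 : ℂ) • curvatureTerm e Q i k) := by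
  have h : ∀ a b, tmap (momentumMulMul e Q a b (k + 1) - momentumMulMul e Q b a (k + 1))
      (insertionInsertion e i a b) = -∑ c, (Complex.I * structureConst e c a b) •
      tmap (momentumMul e Q c k) (insertionInsertion e i a b) := by
    intro a b
    rw [momentumMulMul_sub_succ, tmap_smul_left, tmap_sum_left, Finset.smul_sum,
      ← Finset.sum_neg_distrib]
    refine Finset.sum_congr rfl fun c _ => ?_
    rw [tmap_smul_left, smul_smul, neg_mul]
    exact neg_smul _ _
  have h2 := two_smul_sum_momentumPart_comp e Q i (k + 1)
  simp only [h, Finset.sum_neg_distrib] at h2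
  refine Eq.trans ?_ ((congrArg ((1 / 2 : ℂ) • ·) h2).trans (smul_neg _ _))
  simp only [smul_smul]
  norm_num

theorem sum_antidiagonal_ite_fst {N : Type*} [AddCommMonoid N] (k : ℕ) (F : ℕ → N) :
    ∑ rs ∈ Finset.HasAntidiagonal.antidiagonal (k + 1), (if rs.1 = 1 then F rs.2 else 0) = F k := by
  rw [Finset.sum_eq_single (1, k)]
  · simp
  · rintro ⟨a, b⟩ h hne
    refine if_neg ?_
    rintro rfl
    simp only [Finset.HasAntidiagonal.mem_antidiagonal] at h
    exact hne (by rw [show b = k by omega])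
  · simp [add_comm]

theorem sum_antidiagonal_ite_snd {N : Type*} [AddCommMonoid N] (k : ℕ) (F : ℕ → N) :
    ∑ rs ∈ Finset.HasAntidiagonal.antidiagonal (k + 1), (if rs.2 = 1 then F rs.1 else 0) = F k := by
  rw [Formal.sum_antidiagonal_flip (k + 1) fun r s => if s = 1 then F r else 0]
  exact sum_antidiagonal_ite_fst k F

/-- At order k + 1 the momentum square is minus half of `curvatureTerm` and the cross terms are plus
half of it, both with momentum multiplication of order k. The factor 1/2 in q matches the 1/2 from
antisymmetrising. -/
theorem qKoszulCoeff_comp (i N : ℕ) :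
    ∑ rs ∈ Finset.HasAntidiagonal.antidiagonal N,
      qKoszulCoeff e Q i rs.1 ∘ₗ qKoszulCoeff e Q (i + 1) rs.2 = 0 := by
  have hsplit : ∀ r s, qKoszulCoeff e Q i r ∘ₗ qKoszulCoeff e Q (i + 1) s
      = momentumPart e Q i r ∘ₗ momentumPart e Q (i + 1) s
        + ((if s = 1 then momentumPart e Q i r ∘ₗ modularPart e m M (i + 1) else 0)
          + if r = 1 then modularPart e m M i ∘ₗ momentumPart e Q (i + 1) s else 0) := by
    intro r s
    have hq : ∀ i r, qKoszulCoeff e Q i r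
        = momentumPart e Q i r + if r = 1 then modularPart e m M i else 0 := fun _ _ => rfl
    rw [hq, hq]
    generalize momentumPart e Q i r = A
    generalize momentumPart e Q (i + 1) s = A'
    have hRR := modularPart_comp (m := m) (M := M) e i
    revert hRR
    generalize modularPart e m M i = R
    generalize modularPart e m M (i + 1) = R'
    intro hRR
    rw [LinearMap.add_comp, LinearMap.comp_add, LinearMap.comp_add]
    split_ifs <;> simp [hRR, add_assoc]
  simp only [hsplit, Finset.sum_add_distrib]
  rw [sum_momentumPart_comp]
  cases N with
  | zero =>
    rw [sum_momentumPart_comp_zero]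
    simp
  | succ k =>
    rw [sum_momentumPart_comp_succ,
      sum_antidiagonal_ite_snd k fun r => momentumPart e Q i r ∘ₗ modularPart e m M (i + 1),
      sum_antidiagonal_ite_fst k fun s => modularPart e m M i ∘ₗ momentumPart e Q (i + 1) s,
      momentumPart_modularPart]
    exact neg_add_cancel _

theorem qKoszul_comp_qKoszul (i : ℕ) : qKoszul e Q i ∘ₗ qKoszul e Q (i + 1) = 0 := by
  rw [qKoszul, qKoszul, Formal.opSeries_comp, ← Formal.opSeries_zero]
  congr 1
  funext N
  simp only [ext_comp]
  rw [← map_sum, qKoszulCoeff_comp, map_zero]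

end QuantumBoundary

/-! ### Abstract perturbation algebra -/

section Perturbation

variable {R C A A' A'' : Type*} [CommRing R] [AddCommGroup C] [Module R C] [AddCommGroup A]
  [Module R A] [AddCommGroup A'] [Module R A'] [AddCommGroup A''] [Module R A'']
  {r : A →ₗ[R] C} {p : C →ₗ[R] A} {d : A' →ₗ[R] A} {h : A →ₗ[R] A'}
  {d' : A'' →ₗ[R] A'} {h' : A' →ₗ[R] A''} {N : Module.End R A}

theorem mul_ringInverse_of_isUnit (hN : IsUnit N) : N ∘ₗ Ring.inverse N = LinearMap.id :=
  Ring.mul_inverse_cancel N hN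

theorem ringInverse_mul_of_isUnit (hN : IsUnit N) : Ring.inverse N ∘ₗ N = LinearMap.id :=
  Ring.inverse_mul_cancel N hN

/-- The two hypotheses on p give N p = p directly; all later cancellations rest on this. -/
theorem ringInverse_comp_prol (hN : IsUnit N) (hNeq : N = p ∘ₗ r + d ∘ₗ h)
    (hrp : r ∘ₗ p = LinearMap.id) (hhp : h ∘ₗ p = 0) : Ring.inverse N ∘ₗ p = p := by
  have h1 : N ∘ₗ p = p := by
    rw [hNeq, LinearMap.add_comp, LinearMap.comp_assoc, LinearMap.comp_assoc, hrp, hhp,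
      LinearMap.comp_zero, LinearMap.comp_id, add_zero]
  calc Ring.inverse N ∘ₗ p = Ring.inverse N ∘ₗ N ∘ₗ p := by rw [h1]
    _ = p := by rw [← LinearMap.comp_assoc, ringInverse_mul_of_isUnit hN, LinearMap.id_comp]

theorem restr_comp_ringInverse_comp_prol (hN : IsUnit N) (hNeq : N = p ∘ₗ r + d ∘ₗ h)
    (hrp : r ∘ₗ p = LinearMap.id) (hhp : h ∘ₗ p = 0) :
    (r ∘ₗ Ring.inverse N) ∘ₗ p = LinearMap.id := by
  rw [LinearMap.comp_assoc, ringInverse_comp_prol hN hNeq hrp hhp, hrp]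

theorem prol_restr_add_ringInverse (hN : IsUnit N) (hNeq : N = p ∘ₗ r + d ∘ₗ h) :
    p ∘ₗ (r ∘ₗ Ring.inverse N) + d ∘ₗ (h ∘ₗ Ring.inverse N) = LinearMap.id := by
  rw [← LinearMap.comp_assoc, ← LinearMap.comp_assoc, ← LinearMap.add_comp, ← hNeq,
    mul_ringInverse_of_isUnit hN]

/-- Composing p r N⁻¹ + d h N⁻¹ = id on the left with r N⁻¹ reproduces r N⁻¹ from the first summand,
so the second contributes zero; N⁻¹ is then cancelled. -/
theorem restr_comp_boundary_comp_homotopy (hN : IsUnit N) (hNeq : N = p ∘ₗ r + d ∘ₗ h)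
    (hrp : r ∘ₗ p = LinearMap.id) (hhp : h ∘ₗ p = 0) :
    (r ∘ₗ Ring.inverse N) ∘ₗ d ∘ₗ h = 0 := by
  have h1 := congrArg (fun T => (r ∘ₗ Ring.inverse N) ∘ₗ T) (prol_restr_add_ringInverse hN hNeq)
  simp only [LinearMap.comp_add, LinearMap.comp_id] at h1
  rw [← LinearMap.comp_assoc, restr_comp_ringInverse_comp_prol hN hNeq hrp hhp,
    LinearMap.id_comp, add_eq_left] at h1
  have h2 := congrArg (fun T => T ∘ₗ N) h1
  simp only [LinearMap.zero_comp, LinearMap.comp_assoc] at h2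
  rwa [ringInverse_mul_of_isUnit hN, LinearMap.comp_id, ← LinearMap.comp_assoc] at h2

/-- D and N differ by a map into the image of p, on which N⁻¹ is the identity and h vanishes. Hence
h N⁻¹ D = h. -/
theorem homotopy_comp_ringInverse_mixed (hN : IsUnit N) (hNeq : N = p ∘ₗ r + d ∘ₗ h)
    (hrp : r ∘ₗ p = LinearMap.id) (hhp : h ∘ₗ p = 0)
    {D : Module.End R A} (hD : IsUnit D) (hDeq : D = p ∘ₗ (r ∘ₗ Ring.inverse N) + d ∘ₗ h) :
    h ∘ₗ Ring.inverse D = h ∘ₗ Ring.inverse N := by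
  have h1 : D = N + p ∘ₗ (r ∘ₗ Ring.inverse N - r) := by
    rw [hDeq, LinearMap.comp_sub, eq_sub_of_add_eq' hNeq.symm]
    abel
  have h2 : h ∘ₗ Ring.inverse N ∘ₗ D = h := by
    rw [h1, LinearMap.comp_add, ringInverse_mul_of_isUnit hN, ← LinearMap.comp_assoc _ p,
      ringInverse_comp_prol hN hNeq hrp hhp, LinearMap.comp_add, ← LinearMap.comp_assoc, hhp,
      LinearMap.zero_comp, LinearMap.comp_id, add_zero]
  calc h ∘ₗ Ring.inverse D = (h ∘ₗ Ring.inverse N ∘ₗ D) ∘ₗ Ring.inverse D := by rw [h2]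
    _ = h ∘ₗ Ring.inverse N := by
      rw [LinearMap.comp_assoc, LinearMap.comp_assoc, mul_ringInverse_of_isUnit hD,
        LinearMap.comp_id]

/-- Precomposed with h d + d' h', the claim splits into the known vanishing of r N⁻¹ d h and d d' =
0; the precomposed operator is invertible. -/
theorem restr_comp_boundary (hN : IsUnit N) (hNeq : N = p ∘ₗ r + d ∘ₗ h)
    (hrp : r ∘ₗ p = LinearMap.id) (hhp : h ∘ₗ p = 0) (hdd : d ∘ₗ d' = 0)
    (hD : IsUnit (h ∘ₗ d + d' ∘ₗ h' : Module.End R A')) :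
    (r ∘ₗ Ring.inverse N) ∘ₗ d = 0 := by
  have h1 : ((r ∘ₗ Ring.inverse N) ∘ₗ d) ∘ₗ (h ∘ₗ d + d' ∘ₗ h') = 0 := by
    rw [LinearMap.comp_add, ← LinearMap.comp_assoc _ d', LinearMap.comp_assoc d', hdd,
      LinearMap.comp_zero, LinearMap.zero_comp, add_zero, ← LinearMap.comp_assoc,
      LinearMap.comp_assoc h, restr_comp_boundary_comp_homotopy hN hNeq hrp hhp,
      LinearMap.zero_comp]
  have h2 := congrArg (fun T => T ∘ₗ Ring.inverse (h ∘ₗ d + d' ∘ₗ h' : Module.End R A')) h1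
  simp only [LinearMap.comp_assoc, LinearMap.zero_comp] at h2
  rw [mul_ringInverse_of_isUnit hD, LinearMap.comp_id] at h2
  exact h2

theorem ringInverse_comp_comm {D : Module.End R A} {D' : Module.End R A'} (hD : IsUnit D)
    (hD' : IsUnit D') (hcomm : D ∘ₗ d = d ∘ₗ D') :
    Ring.inverse D ∘ₗ d = d ∘ₗ Ring.inverse D' := by
  calc Ring.inverse D ∘ₗ d = Ring.inverse D ∘ₗ (d ∘ₗ D') ∘ₗ Ring.inverse D' := by
        rw [LinearMap.comp_assoc, mul_ringInverse_of_isUnit hD', LinearMap.comp_id]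
    _ = d ∘ₗ Ring.inverse D' := by
        rw [← hcomm, LinearMap.comp_assoc, ← LinearMap.comp_assoc,
          ringInverse_mul_of_isUnit hD, LinearMap.id_comp]

/-- Commutation turns D⁻¹ d into d times the inverse of h d + d' h', after which both summands share
that inverse on the right. -/
theorem homotopy_identity_of_comm {D : Module.End R A} (hD : IsUnit D)
    (hD' : IsUnit (h ∘ₗ d + d' ∘ₗ h' : Module.End R A'))
    (hcomm : D ∘ₗ d = d ∘ₗ (h ∘ₗ d + d' ∘ₗ h')) :
    d' ∘ₗ (h' ∘ₗ Ring.inverse (h ∘ₗ d + d' ∘ₗ h' : Module.End R A'))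
      + (h ∘ₗ Ring.inverse D) ∘ₗ d = LinearMap.id := by
  rw [LinearMap.comp_assoc, ringInverse_comp_comm hD hD' hcomm, ← LinearMap.comp_assoc,
    ← LinearMap.comp_assoc, ← LinearMap.add_comp, add_comm, mul_ringInverse_of_isUnit hD']

end Perturbation

/-! ### The deformed homotopy and acyclicity of the quantum complex -/

section QuantumHomotopy

variable {m : ℕ} {M : Type*} [TopologicalSpace M] [ChartedSpace (EuclideanSpace ℝ (Fin m)) M]
  {g : Type*} [LieRing g] [LieAlgebra ℝ g] {P : PoissonStructure m M} {S : StarProduct P}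
  {n : ℕ} {e : Module.Basis (Fin n) ℝ g} (Q : QuantumMomentumMap S g)
  (H : ClassicalHomotopy e (Q.J 0) (Q.smooth 0))

theorem cRestr_comp_cProl : cRestr Q ∘ₗ cProl Q H = LinearMap.id := by
  rw [cRestr, cProl, ← Formal.map_comp, ext_comp, ← Formal.map_id, ← evenExt_id]
  congr 2
  rw [← H.restrict_prol]
  ext1 f
  simp

theorem cProl_comp_cRestr_add : cProl Q H ∘ₗ cRestr Q + cKoszul e Q 0 ∘ₗ cHomotopy Q H 0
    = LinearMap.id := by
  rw [cRestr, cProl, cKoszul, cHomotopy, ← Formal.map_comp, ← Formal.map_comp, ext_comp, ext_comp,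
    ← Formal.map_add, ← map_add, ← Formal.map_id, ← evenExt_id, ← H.homotopy_zero]
  rfl

theorem cHomotopy_comp_cKoszul_add (i : ℕ) :
    cHomotopy Q H i ∘ₗ cKoszul e Q i + cKoszul e Q (i + 1) ∘ₗ cHomotopy Q H (i + 1)
      = LinearMap.id := by
  rw [cHomotopy, cHomotopy, cKoszul, cKoszul, ← Formal.map_comp, ← Formal.map_comp, ext_comp,
    ext_comp, ← Formal.map_add, ← map_add, ← Formal.map_id, ← evenExt_id, ← H.homotopy_succ]

theorem cHomotopy_comp_cProl : cHomotopy Q H 0 ∘ₗ cProl Q H = 0 := by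
  rw [cHomotopy, cProl, ← Formal.map_comp, ext_comp, H.h_zero_prol, map_zero, Formal.map_zero]

/-- The operator `(1 / lam) * (cKoszul - qKoszul)` in arbitrary antighost degree. -/
def koszulDefect (e : Module.Basis (Fin n) ℝ g) (i : ℕ) :
    Formal (BRST m M g (i + 1)) →ₗ[ℂ⟦X⟧] Formal (BRST m M g i) :=
  Formal.opSeries fun r => -ext g (qKoszulCoeff e Q i (r + 1))

theorem X_smul_koszulDefect (e : Module.Basis (Fin n) ℝ g) (i : ℕ) :
    (PowerSeries.X : ℂ⟦X⟧) • koszulDefect Q e i = cKoszul e Q i - qKoszul e Q i := by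
  ext1 v
  ext1
  funext k
  rw [LinearMap.smul_apply, LinearMap.sub_apply, Formal.coeff_sub]
  have hX := Formal.coeff_X_pow_smul 1 (koszulDefect Q e i v) k
  rw [pow_one] at hX
  rw [hX]
  cases k with
  | zero => simp [cKoszul, qKoszul, Formal.coeff_opSeries, qKoszulCoeff_zero]
  | succ k =>
    simp [cKoszul, qKoszul, koszulDefect, Formal.coeff_opSeries, Finset.Nat.antidiagonal_succ,
      qKoszulCoeff_zero]

theorem qKoszul_eq_sub (e : Module.Basis (Fin n) ℝ g) (i : ℕ) :
    qKoszul e Q i = cKoszul e Q i - (PowerSeries.X : ℂ⟦X⟧) • koszulDefect Q e i := by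
  rw [X_smul_koszulDefect, sub_sub_cancel]

theorem isUnit_oneSubB1h0 : IsUnit (oneSubB1h0 Q H) :=
  Formal.isUnit_one_sub_X_smul _

/-- The classical identity in degree zero, with the classical boundary traded for the quantum one.
It puts the operator in the form N of the perturbation lemmas. -/
theorem oneSubB1h0_eq :
    oneSubB1h0 Q H = cProl Q H ∘ₗ cRestr Q + qKoszul e Q 0 ∘ₗ cHomotopy Q H 0 := by
  rw [oneSubB1h0, ← LinearMap.smul_comp, lam_smul_B1, LinearMap.sub_comp, Module.End.one_eq_id,
    ← cProl_comp_cRestr_add Q H]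
  abel

/-- Each operator is the identity up to a multiple of lambda. In degree zero the correction is p r
(N⁻¹ - 1) = p r N⁻¹ (1 - N) on top of N, and 1 - N is such a multiple. -/
theorem isUnit_mixed (i : ℕ) : IsUnit (mixed Q H i) := by
  cases i with
  | zero =>
    have h1 : mixed Q H 0 = 1 - (PowerSeries.X : ℂ⟦X⟧) • ((1 - cProl Q H ∘ₗ cRestr Q ∘ₗ
        Ring.inverse (oneSubB1h0 Q H)) ∘ₗ (B1 e Q ∘ₗ cHomotopy Q H 0)) := by
      have h2 : (PowerSeries.X : ℂ⟦X⟧) • (B1 e Q ∘ₗ cHomotopy Q H 0) = 1 - oneSubB1h0 Q H := by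
        rw [oneSubB1h0, sub_sub_cancel]
      have h3 : mixed Q H 0 = cProl Q H ∘ₗ (cRestr Q ∘ₗ Ring.inverse (oneSubB1h0 Q H))
          + qKoszul e Q 0 ∘ₗ cHomotopy Q H 0 := rfl
      rw [← LinearMap.comp_smul, h2, h3, eq_sub_of_add_eq' (oneSubB1h0_eq Q H).symm,
        LinearMap.sub_comp, Module.End.one_eq_id, LinearMap.id_comp, LinearMap.comp_assoc,
        LinearMap.comp_assoc, LinearMap.comp_sub, LinearMap.comp_id,
        ringInverse_mul_of_isUnit (isUnit_oneSubB1h0 Q H), LinearMap.comp_sub, LinearMap.comp_sub,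
        LinearMap.comp_id]
      abel
    rw [h1]
    exact Formal.isUnit_one_sub_X_smul _
  | succ i =>
    have h1 : mixed Q H (i + 1) = 1 - (PowerSeries.X : ℂ⟦X⟧) •
        (cHomotopy Q H i ∘ₗ koszulDefect Q e i
          + koszulDefect Q e (i + 1) ∘ₗ cHomotopy Q H (i + 1)) := by
      rw [mixed, qKoszul_eq_sub, qKoszul_eq_sub, LinearMap.comp_sub, LinearMap.sub_comp,
        Module.End.one_eq_id, ← cHomotopy_comp_cKoszul_add Q H i, LinearMap.comp_smul,
        LinearMap.smul_comp, smul_add]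
      abel
    rw [h1]
    exact Formal.isUnit_one_sub_X_smul _

theorem qHomotopy_zero :
    qHomotopy Q H 0 = cHomotopy Q H 0 ∘ₗ Ring.inverse (oneSubB1h0 Q H) :=
  homotopy_comp_ringInverse_mixed (isUnit_oneSubB1h0 Q H) (oneSubB1h0_eq Q H)
    (cRestr_comp_cProl Q H) (cHomotopy_comp_cProl Q H) (isUnit_mixed Q H 0) rfl

theorem qRestr_comp_cProl : qRestr Q H ∘ₗ cProl Q H = LinearMap.id :=
  restr_comp_ringInverse_comp_prol (isUnit_oneSubB1h0 Q H) (oneSubB1h0_eq Q H)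
    (cRestr_comp_cProl Q H) (cHomotopy_comp_cProl Q H)

theorem qRestr_comp_qKoszul : qRestr Q H ∘ₗ qKoszul e Q 0 = 0 :=
  restr_comp_boundary (isUnit_oneSubB1h0 Q H) (oneSubB1h0_eq Q H)
    (cRestr_comp_cProl Q H) (cHomotopy_comp_cProl Q H) (qKoszul_comp_qKoszul e Q 0)
    (isUnit_mixed Q H 1)

theorem cProl_comp_qRestr_add :
    cProl Q H ∘ₗ qRestr Q H + qKoszul e Q 0 ∘ₗ qHomotopy Q H 0 = LinearMap.id := by
  rw [qHomotopy_zero]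
  exact prol_restr_add_ringInverse (isUnit_oneSubB1h0 Q H) (oneSubB1h0_eq Q H)

/-- Both sides equal d h d: the remaining terms contain d d, or r N⁻¹ d in degree zero. -/
theorem mixed_comp_qKoszul (i : ℕ) :
    mixed Q H i ∘ₗ qKoszul e Q i = qKoszul e Q i ∘ₗ mixed Q H (i + 1) := by
  have h1 : qKoszul e Q i ∘ₗ mixed Q H (i + 1)
      = (qKoszul e Q i ∘ₗ cHomotopy Q H i) ∘ₗ qKoszul e Q i := by
    rw [mixed, LinearMap.comp_add, ← LinearMap.comp_assoc, ← LinearMap.comp_assoc,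
      qKoszul_comp_qKoszul, LinearMap.zero_comp, add_zero]
  rw [h1]
  cases i with
  | zero =>
    rw [mixed, LinearMap.add_comp, LinearMap.comp_assoc _ _ (cProl Q H), qRestr_comp_qKoszul,
      LinearMap.comp_zero]
    exact zero_add _
  | succ i =>
    rw [mixed, LinearMap.add_comp, LinearMap.comp_assoc _ _ (cHomotopy Q H i), qKoszul_comp_qKoszul,
      LinearMap.comp_zero]
    exact zero_add _

theorem qKoszul_comp_qHomotopy_add (i : ℕ) :
    qKoszul e Q (i + 1) ∘ₗ qHomotopy Q H (i + 1) + qHomotopy Q H i ∘ₗ qKoszul e Q i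
      = LinearMap.id :=
  homotopy_identity_of_comm (isUnit_mixed Q H i) (isUnit_mixed Q H (i + 1))
    (mixed_comp_qKoszul Q H i)

theorem augBoundary_comp_augHomotopy_add :
    augBoundary Q H ∘ₗ augHomotopy Q H + augHomotopy Q H ∘ₗ augBoundary Q H = LinearMap.id := by
  refine LinearMap.ext fun x => Prod.ext ?_ (funext fun i => ?_)
  · have h := LinearMap.congr_fun (qRestr_comp_cProl Q H) x.1
    change qRestr Q H (cProl Q H x.1) + 0 = x.1
    rw [add_zero]
    exact h
  · cases i with
    | zero =>
      have h := LinearMap.congr_fun (cProl_comp_qRestr_add Q H) (x.2 0)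
      change qKoszul e Q 0 (qHomotopy Q H 0 (x.2 0)) + cProl Q H (qRestr Q H (x.2 0)) = x.2 0
      rw [add_comm]
      exact h
    | succ i => exact LinearMap.congr_fun (qKoszul_comp_qHomotopy_add Q H i) (x.2 (i + 1))

theorem augBoundary_comp_augBoundary : augBoundary Q H ∘ₗ augBoundary Q H = 0 := by
  refine LinearMap.ext fun x => Prod.ext ?_ (funext fun i => ?_)
  · exact LinearMap.congr_fun (qRestr_comp_qKoszul Q H) (x.2 1)
  · exact LinearMap.congr_fun (qKoszul_comp_qKoszul e Q i) (x.2 (i + 1 + 1))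

theorem exact_augBoundary : Function.Exact (augBoundary Q H) (augBoundary Q H) := by
  intro x
  constructor
  · intro hx
    refine ⟨augHomotopy Q H x, ?_⟩
    have h := LinearMap.congr_fun (augBoundary_comp_augHomotopy_add Q H) x
    rw [LinearMap.add_apply, LinearMap.comp_apply, LinearMap.comp_apply, hx, map_zero,
      add_zero] at h
    exact h
  · rintro ⟨y, rfl⟩
    exact LinearMap.congr_fun (augBoundary_comp_augBoundary Q H) y

end QuantumHomotopy

/-! ### Contractibility of exact complexes of vector spaces -/

section Splitting

variable {K : Type*} [Field K]

/-- Split the map onto its range, then extend the section to the whole target by a linear extension.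
-/
theorem exists_section_on_range {V W : Type*} [AddCommGroup V] [Module K V] [AddCommGroup W]
    [Module K W] (f : V →ₗ[K] W) : ∃ s : W →ₗ[K] V, ∀ x, f (s (f x)) = f x := by
  obtain ⟨s, hs⟩ := f.rangeRestrict.exists_rightInverse_of_surjective f.range_rangeRestrict
  obtain ⟨t, ht⟩ := s.exists_extend
  refine ⟨t, fun x => ?_⟩
  have h1 : t (f x) = s ⟨f x, x, rfl⟩ := LinearMap.congr_fun ht ⟨f x, x, rfl⟩
  rw [h1]
  exact congrArg Subtype.val (LinearMap.congr_fun hs ⟨f x, x, rfl⟩)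

/-- An exact augmented complex of vector spaces has a contracting homotopy. -/
theorem exists_contracting_homotopy {C : Type*} [AddCommGroup C] [Module K C] {A : ℕ → Type*}
    [∀ i, AddCommGroup (A i)] [∀ i, Module K (A i)] (ε : A 0 →ₗ[K] C)
    (d : ∀ i, A (i + 1) →ₗ[K] A i) (hε : Function.Surjective ε) (hεd : ∀ x, ε (d 0 x) = 0)
    (hdd : ∀ i x, d i (d (i + 1) x) = 0) (h0 : ∀ x, ε x = 0 → ∃ y, d 0 y = x)
    (hex : ∀ i x, d i x = 0 → ∃ y, d (i + 1) y = x) :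
    ∃ (p : C →ₗ[K] A 0) (h : ∀ i, A i →ₗ[K] A (i + 1)),
      (∀ c, ε (p c) = c) ∧ (∀ x, p (ε x) + d 0 (h 0 x) = x) ∧
      (∀ i x, h i (d i x) + d (i + 1) (h (i + 1) x) = x) ∧ ∀ c, h 0 (p c) = 0 := by
  obtain ⟨p, hp⟩ := ε.exists_rightInverse_of_surjective (LinearMap.range_eq_top.2 hε)
  have hp' : ∀ c, ε (p c) = c := LinearMap.congr_fun hp
  choose s hs using fun i => exists_section_on_range (d i)
  -- Each homotopy corrects x by the previous one to a cycle, then takes a primitive. Starting from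
  -- `id - p ∘ ε` makes the first one vanish on the image of p.
  let h : ∀ i, A i →ₗ[K] A (i + 1) := fun i =>
    Nat.rec (motive := fun i => A i →ₗ[K] A (i + 1)) (s 0 ∘ₗ (LinearMap.id - p ∘ₗ ε))
      (fun i hi => s (i + 1) ∘ₗ (LinearMap.id - hi ∘ₗ d i)) i
  have hzero : ∀ x, h 0 x = s 0 (x - p (ε x)) := fun _ => rfl
  have hsucc : ∀ i x, h (i + 1) x = s (i + 1) (x - h i (d i x)) := fun _ _ => rfl
  have key0 : ∀ x, p (ε x) + d 0 (h 0 x) = x := by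
    intro x
    obtain ⟨y, hy⟩ := h0 (x - p (ε x)) (by rw [map_sub, hp', sub_self])
    rw [hzero, ← hy, hs, hy, add_sub_cancel]
  have key : ∀ i x, h i (d i x) + d (i + 1) (h (i + 1) x) = x := by
    have step : ∀ i, (∀ x, d i (h i (d i x)) = d i x) →
        ∀ x, h i (d i x) + d (i + 1) (h (i + 1) x) = x := by
      intro i hi x
      obtain ⟨y, hy⟩ := hex i (x - h i (d i x)) (by rw [map_sub, hi, sub_self])
      rw [hsucc, ← hy, hs, hy, add_sub_cancel]
    intro i
    induction i with
    | zero =>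
      refine step 0 fun x => ?_
      have := key0 (d 0 x)
      rwa [hεd, map_zero, zero_add] at this
    | succ i ih =>
      refine step (i + 1) fun x => ?_
      have := ih (d (i + 1) x)
      rwa [hdd, map_zero, zero_add] at this
  exact ⟨p, h, hp', key0, key, fun c => by rw [hzero, hp', sub_self, map_zero]⟩

end Splitting

/-! ### Koszul complexes of commuting operators with division -/

section KoszulOperators

variable {g : Type*} [LieRing g] [LieAlgebra ℝ g] {n : ℕ} (e : Module.Basis (Fin n) ℝ g)
  {A B : Type*} [AddCommGroup A] [Module ℝ A] [Module ℂ A] [IsScalarTower ℝ ℂ A]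
  [AddCommGroup B] [Module ℝ B] [Module ℂ B] [IsScalarTower ℝ ℂ B]

/-- The Koszul boundary operator of a family of linear operators. -/
def koszulOp (x : Fin n → B →ₗ[ℂ] B) (i : ℕ) :
    B ⊗[ℝ] ⋀[ℝ]^(i + 1) g →ₗ[ℂ] B ⊗[ℝ] ⋀[ℝ]^i g :=
  ∑ a, tmap (x a) (insertion (e.coord a) i)

/-- Symmetric products against antisymmetric insertions: the square equals its own negative. -/
theorem koszulOp_comp_koszulOp {x : Fin n → B →ₗ[ℂ] B}
    (hx : ∀ a b, x a ∘ₗ x b = x b ∘ₗ x a) (i : ℕ) :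
    koszulOp e x i ∘ₗ koszulOp e x (i + 1) = 0 := by
  have h1 : koszulOp e x i ∘ₗ koszulOp e x (i + 1)
      = ∑ a, ∑ b, tmap (x a ∘ₗ x b)
        (insertion (e.coord a) i ∘ₗ insertion (e.coord b) (i + 1)) := by
    simp only [koszulOp, sum_linearMap_comp, linearMap_comp_sum, tmap_comp_tmap]
    exact Finset.sum_comm
  have h2 : koszulOp e x i ∘ₗ koszulOp e x (i + 1)
      = -(koszulOp e x i ∘ₗ koszulOp e x (i + 1)) := by
    conv_lhs => rw [h1, Finset.sum_comm]
    rw [h1, ← Finset.sum_neg_distrib]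
    refine Finset.sum_congr rfl fun a _ => ?_
    rw [← Finset.sum_neg_distrib]
    refine Finset.sum_congr rfl fun b _ => ?_
    rw [hx, insertion_insertion, tmap_neg_right]
  refine (smul_eq_zero.1 ?_).resolve_left (two_ne_zero (α := ℂ))
  rw [two_smul]
  nth_rewrite 1 [h2]
  exact neg_add_cancel _

theorem koszulOp_natural {x : Fin n → A →ₗ[ℂ] A} {y : Fin n → B →ₗ[ℂ] B} (T : A →ₗ[ℂ] B)
    (hT : ∀ a, T ∘ₗ x a = y a ∘ₗ T) (i : ℕ) :
    tmap T LinearMap.id ∘ₗ koszulOp e x i = koszulOp e y i ∘ₗ tmap T LinearMap.id := by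
  simp only [koszulOp, sum_linearMap_comp, linearMap_comp_sum, tmap_comp_tmap, hT,
    LinearMap.comp_id, LinearMap.id_comp]

/-- The projection onto the forms without `e a`. -/
def killBasis (a : Fin n) (i : ℕ) : Module.End ℝ (⋀[ℝ]^i g) :=
  insertion (e.coord a) i ∘ₗ wedge (e a) i

theorem killBasis_zero (a : Fin n) : killBasis e a 0 = LinearMap.id := by
  rw [killBasis, insertion_wedge_zero]
  simp

theorem killBasis_succ (a : Fin n) (i : ℕ) :
    killBasis e a (i + 1) + wedge (e a) i ∘ₗ insertion (e.coord a) i = LinearMap.id := by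
  rw [killBasis, insertion_wedge]
  simp

theorem insertion_killBasis_self (a : Fin n) (i : ℕ) :
    insertion (e.coord a) i ∘ₗ killBasis e a (i + 1) = 0 :=
  LinearMap.ext fun _ => Subtype.ext (CliffordAlgebra.contractLeft_contractLeft _ _)

theorem insertion_killBasis_of_ne {a b : Fin n} (hab : a ≠ b) (i : ℕ) :
    insertion (e.coord b) i ∘ₗ killBasis e a (i + 1)
      = killBasis e a i ∘ₗ insertion (e.coord b) i := by
  have hba : e.coord b (e a) = 0 := by simp [Finsupp.single_eq_of_ne hab.symm]
  refine LinearMap.ext fun x => Subtype.ext ?_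
  simp only [killBasis, LinearMap.comp_apply, coe_insertion, coe_wedge, exteriorMul_apply]
  have h1 := interior_ι_mul (e.coord b) (e a) (x : ExteriorAlgebra ℝ g)
  rw [hba, zero_smul, zero_sub] at h1
  refine (CliffordAlgebra.contractLeft_comm (e.coord b) (e.coord a) _).trans ?_
  refine (congrArg (fun y => -interior (e.coord a) y) h1).trans ?_
  rw [map_neg, neg_neg]

theorem insertion_killBasis_prod {l : List (Fin n)} {b : Fin n} (hb : b ∈ l) (i : ℕ) :
    insertion (e.coord b) i ∘ₗ (l.map fun a => killBasis e a (i + 1)).prod = 0 := by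
  induction l with
  | nil => simp at hb
  | cons a l ih =>
    rw [List.map_cons, List.prod_cons, Module.End.mul_eq_comp, ← LinearMap.comp_assoc]
    by_cases hab : a = b
    · rw [hab, insertion_killBasis_self, LinearMap.zero_comp]
    · rw [insertion_killBasis_of_ne e hab, LinearMap.comp_assoc,
        ih ((List.mem_cons.1 hb).resolve_left (Ne.symm hab)), LinearMap.comp_zero]

/-- Each contraction commutes past the factors with another index and is killed by its own, so the
product maps into the elements of positive degree annihilated by all contractions. -/
theorem killBasis_prod_eq_zero {l : List (Fin n)} (hl : ∀ b, b ∈ l) (i : ℕ) :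
    (l.map fun a => killBasis e a (i + 1)).prod = 0 := by
  refine LinearMap.ext fun x => Subtype.ext ?_
  refine eq_zero_of_interior_eq_zero e i _ (Subtype.property _) fun c => ?_
  exact congrArg Subtype.val (LinearMap.congr_fun (insertion_killBasis_prod e (hl c) i) x)

/-- A family of commuting operators together with operators of division with remainder, which
behave like the coordinates of a vector space acting on its smooth functions. -/
structure DivisionOperators (x T R : Fin n → Module.End ℂ B) : Prop where
  comm : ∀ a b, x a ∘ₗ x b = x b ∘ₗ x a
  mul_div : ∀ a, x a ∘ₗ T a + R a = LinearMap.id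
  div_mul : ∀ a, T a ∘ₗ x a = LinearMap.id
  div_comm : ∀ a b, a ≠ b → T a ∘ₗ x b = x b ∘ₗ T a

variable {e} {x T R : Fin n → Module.End ℂ B}

theorem DivisionOperators.homotopy_zero (D : DivisionOperators x T R) (a : Fin n) :
    koszulOp e x 0 ∘ₗ tmap (T a) (wedge (e a) 0) + tmap (R a) (killBasis e a 0)
      = LinearMap.id := by
  simp only [koszulOp, sum_linearMap_comp, tmap_comp_tmap, insertion_wedge_zero]
  rw [Finset.sum_eq_single a]
  · rw [killBasis_zero]
    simp only [Module.Basis.coord_apply, Module.Basis.repr_self, Finsupp.single_eq_same, one_smul]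
    rw [← tmap_add_left, D.mul_div, tmap_id_id]
  · intro b _ hb
    simp [Finsupp.single_eq_of_ne hb, tmap_zero_right]
  · simp

/-- Indices b ≠ a cancel, since the division commutes with x b and wedge anticommutes with
insertion. For b = a, the division inverts x a exactly on one side and up to the remainder on the
other, so the defect is the remainder tensored with `killBasis`. -/
theorem DivisionOperators.homotopy_succ (D : DivisionOperators x T R) (a : Fin n) (i : ℕ) :
    koszulOp e x (i + 1) ∘ₗ tmap (T a) (wedge (e a) (i + 1))
      + tmap (T a) (wedge (e a) i) ∘ₗ koszulOp e x i
      + tmap (R a) (killBasis e a (i + 1)) = LinearMap.id := by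
  simp only [koszulOp, sum_linearMap_comp, linearMap_comp_sum, tmap_comp_tmap]
  rw [← Finset.sum_add_distrib, Finset.sum_eq_single a]
  · rw [D.div_mul, ← killBasis, add_right_comm, ← tmap_add_left, D.mul_div, ← tmap_add_right,
      killBasis_succ, tmap_id_id]
  · intro b _ hb
    have hba : e.coord b (e a) = 0 := by simp [Finsupp.single_eq_of_ne hb]
    rw [D.div_comm a b hb.symm, ← tmap_add_right, insertion_wedge, hba, zero_smul, tmap_zero_right]
  · simp

theorem DivisionOperators.exists_zero (D : DivisionOperators x T R) (l : List (Fin n))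
    (z : B ⊗[ℝ] ⋀[ℝ]^0 g) :
    ∃ w, koszulOp e x 0 w + tmap (l.map R).prod LinearMap.id z = z := by
  induction l with
  | nil => exact ⟨0, by rw [map_zero, zero_add]; exact LinearMap.congr_fun tmap_id_id z⟩
  | cons a l ih =>
    obtain ⟨w, hw⟩ := ih
    set y := tmap (l.map R).prod LinearMap.id z with hy
    have h1 := LinearMap.congr_fun (D.homotopy_zero (e := e) a) y
    rw [killBasis_zero, LinearMap.add_apply, LinearMap.comp_apply, LinearMap.id_apply] at h1
    refine ⟨w + tmap (T a) (wedge (e a) 0) y, ?_⟩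
    have h2 : tmap ((a :: l).map R).prod LinearMap.id z = tmap (R a) LinearMap.id y := by
      rw [hy, ← LinearMap.comp_apply, tmap_comp_tmap]
      rfl
    rw [h2, map_add, add_assoc, h1, hw]

/-- One coordinate at a time, a cycle is replaced by a homologous one to which another remainder
operator has been applied. -/
theorem DivisionOperators.exists_succ (D : DivisionOperators x T R) (l : List (Fin n)) (i : ℕ)
    (z : B ⊗[ℝ] ⋀[ℝ]^(i + 1) g) (hz : koszulOp e x i z = 0) :
    ∃ w, koszulOp e x (i + 1) w
      + tmap (l.map R).prod (l.map fun a => killBasis e a (i + 1)).prod z = z := by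
  induction l with
  | nil => exact ⟨0, by rw [map_zero, zero_add]; exact LinearMap.congr_fun tmap_id_id z⟩
  | cons a l ih =>
    obtain ⟨w, hw⟩ := ih
    set y := tmap (l.map R).prod (l.map fun a => killBasis e a (i + 1)).prod z with hy
    have hcyc : koszulOp e x i y = 0 := by
      have h := congrArg (koszulOp e x i) hw
      rwa [map_add, hz, ← LinearMap.comp_apply, koszulOp_comp_koszulOp e D.comm,
        LinearMap.zero_apply, zero_add] at h
    have h1 := LinearMap.congr_fun (D.homotopy_succ (e := e) a i) y
    rw [LinearMap.add_apply, LinearMap.add_apply, LinearMap.comp_apply, LinearMap.comp_apply,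
      LinearMap.id_apply, hcyc, map_zero, add_zero] at h1
    refine ⟨w + tmap (T a) (wedge (e a) (i + 1)) y, ?_⟩
    have h2 : tmap ((a :: l).map R).prod ((a :: l).map fun a => killBasis e a (i + 1)).prod z
        = tmap (R a) (killBasis e a (i + 1)) y := by
      rw [hy, ← LinearMap.comp_apply, tmap_comp_tmap]
      rfl
    rw [h2, map_add, add_assoc, h1, hw]

/-- The Koszul complex of a family of operators with division is exact in positive degree. -/
theorem DivisionOperators.exact (D : DivisionOperators x T R) (i : ℕ)
    (z : B ⊗[ℝ] ⋀[ℝ]^(i + 1) g) (hz : koszulOp e x i z = 0) :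
    ∃ w, koszulOp e x (i + 1) w = z := by
  obtain ⟨w, hw⟩ := D.exists_succ (List.finRange n) i z hz
  refine ⟨w, ?_⟩
  rwa [killBasis_prod_eq_zero e List.mem_finRange, tmap_zero_right, LinearMap.zero_apply,
    add_zero] at hw

end KoszulOperators

/-! ### Hadamard's lemma with smooth dependence on parameters -/

section Hadamard

open MeasureTheory

variable {E : Type*} [NormedAddCommGroup E] [NormedSpace ℝ E]
  {F : Type*} [NormedAddCommGroup F] [NormedSpace ℝ F]

/-- The integral is the value at 0 of a convolution: the indicator of [0, 1] against the reflected
integrand, cut off to have compact support. Smoothness is then that of parametrised convolutions. -/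
theorem contDiff_parametric_integral [CompleteSpace F] {f : E → ℝ → F}
    (hf : ContDiff ℝ ∞ fun q : E × ℝ => f q.1 q.2) :
    ContDiff ℝ ∞ fun y => ∫ t in (0 : ℝ)..1, f y t := by
  -- Equal to 1 on [-1, 1], which contains every -t met in the integral, and zero outside the ball
  -- of radius 2.
  let χ : ContDiffBump (0 : ℝ) := ⟨1, 2, one_pos, one_lt_two⟩
  let γ : E → ℝ → F := fun p s => χ s • f p (-s)
  let u : ℝ → ℝ := (Set.Icc (0 : ℝ) 1).indicator fun _ => 1
  have hγ : ContDiff ℝ ∞ fun q : E × ℝ => γ q.1 q.2 :=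
    (χ.contDiff.comp contDiff_snd).smul (hf.comp (contDiff_fst.prodMk contDiff_snd.neg))
  have hu : LocallyIntegrable u volume :=
    ((integrable_indicator_iff measurableSet_Icc).2
      (continuousOn_const.integrableOn_compact isCompact_Icc)).locallyIntegrable
  have h := contDiffOn_convolution_right_with_param_comp (𝕜 := ℝ) (μ := volume) (n := ⊤)
    (ContinuousLinearMap.lsmul ℝ ℝ : ℝ →L[ℝ] F →L[ℝ] F) (s := (Set.univ : Set E))
    (v := fun _ => (0 : ℝ)) contDiffOn_const (f := u) (g := γ)
    (k := Metric.closedBall 0 2) isOpen_univ (isCompact_closedBall _ _)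
    (by
      intro p s _ hs
      have : χ s = 0 := χ.zero_of_le_dist (not_le.1 hs).le
      simp [γ, this]) hu (by simpa using! hγ.contDiffOn)
  rw [contDiffOn_univ] at h
  convert h using 2 with y
  rw [convolution_def, intervalIntegral.integral_of_le zero_le_one, ← integral_Icc_eq_integral_Ioc,
    ← integral_indicator measurableSet_Icc]
  congr 1
  funext t
  by_cases ht : t ∈ Set.Icc (0 : ℝ) 1
  · have hχ : χ (-t) = 1 := χ.one_of_mem_closedBall (by
      simp only [Metric.mem_closedBall, dist_zero_right, norm_neg, Real.norm_eq_abs]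
      exact abs_le.2 ⟨by linarith [ht.1], ht.2⟩)
    simp [u, γ, ht, hχ]
  · simp [u, ht]

/-- Hadamard's lemma for a hyperplane. -/
theorem exists_contDiff_hadamard [CompleteSpace F] (l : E →L[ℝ] ℝ) (v : E) {f : E → F} (hf : ContDiff ℝ ∞ f) :
    ∃ G : E → F, ContDiff ℝ ∞ G ∧ ∀ y, l y • G y + f (y - l y • v) = f y := by
  -- The segment from the projection of y to the hyperplane up to y; the quotient is the mean of the
  -- derivative in direction v along it.
  let c : E → ℝ → E := fun y t => y - l y • v + t • l y • v
  have hc : ContDiff ℝ ∞ fun q : E × ℝ => c q.1 q.2 := by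
    have hl : ContDiff ℝ ∞ fun q : E × ℝ => l q.1 := l.contDiff.comp contDiff_fst
    exact (contDiff_fst.sub (hl.smul contDiff_const)).add
      (contDiff_snd.smul (hl.smul contDiff_const))
  have hd : ContDiff ℝ ∞ fun q : E × ℝ => fderiv ℝ f (c q.1 q.2) v :=
    ((hf.fderiv_right (m := ∞) (by simp)).comp hc).clm_apply contDiff_const
  refine ⟨fun y => ∫ t in (0 : ℝ)..1, fderiv ℝ f (c y t) v, contDiff_parametric_integral hd, ?_⟩
  intro y
  have hderiv : ∀ t ∈ Set.uIcc (0 : ℝ) 1,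
      HasDerivAt (fun t => f (c y t)) (l y • fderiv ℝ f (c y t) v) t := by
    intro t _
    have h1 : HasDerivAt (fun t => c y t) (l y • v) t := by
      have := ((hasDerivAt_id t).smul_const (l y • v)).const_add (y - l y • v)
      rw [one_smul] at this
      exact this
    have h2 := ((hf.differentiable (by simp)) (c y t)).hasFDerivAt.comp_hasDerivAt t h1
    simpa using! h2
  have hcont : Continuous fun t => l y • fderiv ℝ f (c y t) v :=
    ((hd.continuous).comp (Continuous.prodMk_right y)).const_smul (l y)
  have h := intervalIntegral.integral_eq_sub_of_hasDerivAt hderiv (hcont.intervalIntegrable _ _)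
  rw [intervalIntegral.integral_smul] at h
  rw [h]
  simp [c]

/-- On the line through y in direction v, the functional is the parameter s. The functions agree for
s ≠ 0, a dense set, hence everywhere by continuity. -/
theorem eq_of_smul_eq_smul (l : E →L[ℝ] ℝ) {v : E} (hv : l v = 1) {G G' : E → F}
    (hG : Continuous G) (hG' : Continuous G') (h : ∀ y, l y • G y = l y • G' y) : G = G' := by
  funext y
  have hline : Continuous fun s : ℝ => y + (s - l y) • v := by fun_prop
  have := Continuous.ext_on (dense_compl_singleton (0 : ℝ)) (hG.comp hline) (hG'.comp hline) (by
    intro s hs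
    have h1 := h (y + (s - l y) • v)
    have h2 : l (y + (s - l y) • v) = s := by simp [hv]
    rw [h2] at h1
    exact smul_right_injective F hs h1)
  simpa using congrFun this (l y)

end Hadamard

/-! ### Division by linear coordinates on a vector space -/

section SmoothVec

variable (E : Type*) [NormedAddCommGroup E] [NormedSpace ℝ E]

/-- The algebra of smooth complex-valued functions on a normed space. -/
def smoothVec : Subalgebra ℂ (E → ℂ) where
  carrier := {f | ContDiff ℝ ∞ f}
  mul_mem' {f g} hf hg := by
    have hf : ContDiff ℝ ∞ f := hf
    have hg : ContDiff ℝ ∞ g := hg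
    exact hf.mul hg
  add_mem' {f g} hf hg := by
    have hf : ContDiff ℝ ∞ f := hf
    have hg : ContDiff ℝ ∞ g := hg
    exact hf.add hg
  algebraMap_mem' r := by
    have h : ContDiff ℝ ∞ fun _ : E => r := contDiff_const
    exact h

instance : AddCommGroup (smoothVec E) := inferInstance

instance : Module ℝ (smoothVec E) := inferInstance

instance : Module ℂ (smoothVec E) := inferInstance

instance : IsScalarTower ℝ ℂ (smoothVec E) := inferInstance

variable {E}

theorem contDiff_smoothVec (f : smoothVec E) : ContDiff ℝ ∞ f.1 := f.2

/-- The smooth function with underlying function `f`. -/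
def smoothVec.mk (f : E → ℂ) (hf : ContDiff ℝ ∞ f) : smoothVec E := ⟨f, hf⟩

/-- A continuous linear functional as a smooth function. -/
def linearFun (l : E →L[ℝ] ℝ) : smoothVec E :=
  smoothVec.mk (fun y => (l y : ℂ)) (Complex.ofRealCLM.contDiff.comp l.contDiff)

/-- Pull-back along the projection onto the hyperplane `l = 0` in the direction of `v`. -/
def hyperplaneRestr (l : E →L[ℝ] ℝ) (v : E) : Module.End ℂ (smoothVec E) where
  toFun f := smoothVec.mk (fun y => f.1 (y - l y • v))
    ((contDiff_smoothVec f).comp (contDiff_id.sub (l.contDiff.smul contDiff_const)))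
  map_add' _ _ := rfl
  map_smul' _ _ := rfl

theorem linearFun_mul_cancel {l : E →L[ℝ] ℝ} {v : E} (hv : l v = 1) {G G' : smoothVec E}
    (h : linearFun l * G = linearFun l * G') : G = G' := by
  refine Subtype.ext (eq_of_smul_eq_smul l hv (contDiff_smoothVec G).continuous
    (contDiff_smoothVec G').continuous fun y => ?_)
  have := congrFun (congrArg Subtype.val h) y
  simpa [linearFun, smoothVec.mk] using! this

theorem exists_hyperplaneDiv (l : E →L[ℝ] ℝ) (v : E) (f : smoothVec E) :
    ∃ G : smoothVec E, linearFun l * G + hyperplaneRestr l v f = f := by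
  obtain ⟨G, hG, h⟩ := exists_contDiff_hadamard l v (contDiff_smoothVec f)
  refine ⟨smoothVec.mk G hG, Subtype.ext (funext fun y => ?_)⟩
  refine Eq.trans ?_ (h y)
  simp [linearFun, hyperplaneRestr, smoothVec.mk]

/-- Division with remainder by the linear functional `l`. -/
def hyperplaneDiv {l : E →L[ℝ] ℝ} {v : E} (hv : l v = 1) : Module.End ℂ (smoothVec E) where
  toFun f := (exists_hyperplaneDiv l v f).choose
  map_add' f f' := by
    -- The quotient is a choice, but it is unique, so it is additive because the defining equation
    -- is.
    refine linearFun_mul_cancel hv (add_right_cancel (b := hyperplaneRestr l v (f + f')) ?_)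
    rw [(exists_hyperplaneDiv l v (f + f')).choose_spec]
    conv_lhs => rw [← (exists_hyperplaneDiv l v f).choose_spec,
      ← (exists_hyperplaneDiv l v f').choose_spec]
    rw [map_add]
    ring
  map_smul' z f := by
    refine linearFun_mul_cancel hv (add_right_cancel (b := hyperplaneRestr l v (z • f)) ?_)
    rw [(exists_hyperplaneDiv l v (z • f)).choose_spec]
    conv_lhs => rw [← (exists_hyperplaneDiv l v f).choose_spec]
    rw [map_smul, smul_add, RingHom.id_apply, mul_smul_comm]

theorem linearFun_mul_hyperplaneDiv {l : E →L[ℝ] ℝ} {v : E} (hv : l v = 1) (f : smoothVec E) :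
    linearFun l * hyperplaneDiv hv f + hyperplaneRestr l v f = f :=
  (exists_hyperplaneDiv l v f).choose_spec

theorem hyperplaneRestr_linearFun_mul (l l' : E →L[ℝ] ℝ) {v : E} (hv : l' v = 0)
    (f : smoothVec E) :
    hyperplaneRestr l v (linearFun l' * f) = linearFun l' * hyperplaneRestr l v f := by
  refine Subtype.ext (funext fun y => ?_)
  simp [linearFun, hyperplaneRestr, smoothVec.mk, hv]

theorem hyperplaneRestr_linearFun_mul_self (l : E →L[ℝ] ℝ) {v : E} (hv : l v = 1)
    (f : smoothVec E) : hyperplaneRestr l v (linearFun l * f) = 0 := by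
  refine Subtype.ext (funext fun y => ?_)
  simp [linearFun, hyperplaneRestr, smoothVec.mk, hv]

/-- The laws for division hold after multiplication by the coordinate, which can be cancelled. The
duality of `l` and `v` makes restriction along one coordinate commute with multiplication by the
others. -/
theorem divisionOperators_hyperplane {n : ℕ} {l : Fin n → E →L[ℝ] ℝ} {v : Fin n → E}
    (hself : ∀ a, l a (v a) = 1) (hne : ∀ a b, a ≠ b → l b (v a) = 0) :
    DivisionOperators (fun a => LinearMap.mulLeft ℂ (linearFun (l a)))
      (fun a => hyperplaneDiv (hself a)) (fun a => hyperplaneRestr (l a) (v a)) where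
  comm a b := LinearMap.ext fun f => mul_left_comm _ _ _
  mul_div a := LinearMap.ext fun f => linearFun_mul_hyperplaneDiv (hself a) f
  div_mul a := LinearMap.ext fun f => by
    refine linearFun_mul_cancel (hself a) ?_
    have h := linearFun_mul_hyperplaneDiv (hself a) (linearFun (l a) * f)
    rwa [hyperplaneRestr_linearFun_mul_self _ (hself a), add_zero] at h
  div_comm a b hab := LinearMap.ext fun f => by
    refine linearFun_mul_cancel (hself a) ?_
    have h := linearFun_mul_hyperplaneDiv (hself a) (linearFun (l b) * f)
    have h' := linearFun_mul_hyperplaneDiv (hself a) f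
    rw [hyperplaneRestr_linearFun_mul _ _ (hne a b hab)] at h
    refine add_right_cancel (b := linearFun (l b) * hyperplaneRestr (l a) (v a) f) (h.trans ?_)
    conv_lhs => rw [← h']
    simp only [LinearMap.comp_apply, LinearMap.mulLeft_apply]
    ring

/-- The product of restrictions is evaluation at a successively projected point. The second clause
carries the induction: a coordinate that is already zero stays zero under later projections. -/
theorem exists_hyperplaneRestr_prod {n : ℕ} {l : Fin n → E →L[ℝ] ℝ} {v : Fin n → E}
    (hself : ∀ a, l a (v a) = 1) (hne : ∀ a b, a ≠ b → l b (v a) = 0) (L : List (Fin n)) (y : E) :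
    ∃ y' : E, (∀ a, a ∈ L → l a y' = 0) ∧ (∀ a, l a y = 0 → l a y' = 0) ∧
      ∀ f : smoothVec E, ((L.map fun a => hyperplaneRestr (l a) (v a)).prod f).1 y = f.1 y' := by
  induction L generalizing y with
  | nil => exact ⟨y, by simp, fun _ h => h, fun _ => rfl⟩
  | cons a L ih =>
    obtain ⟨y', h1, h2, h3⟩ := ih (y - l a y • v a)
    refine ⟨y', ?_, ?_, fun f => h3 f⟩
    · intro b hb
      by_cases hba : b = a
      · subst hba
        exact h2 b (by simp [hself])
      · exact h1 b ((List.mem_cons.1 hb).resolve_left hba)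
    · intro b hb
      by_cases hba : b = a
      · subst hba
        exact h2 b (by simp [hself])
      · exact h2 b (by simp [hb, hne a b (Ne.symm hba)])

theorem hyperplaneRestr_prod_eq_zero {n : ℕ} {l : Fin n → E →L[ℝ] ℝ} {v : Fin n → E}
    (hself : ∀ a, l a (v a) = 1) (hne : ∀ a b, a ≠ b → l b (v a) = 0) {f : smoothVec E}
    (hf : ∀ y, (∀ a, l a y = 0) → f.1 y = 0) :
    ((List.finRange n).map fun a => hyperplaneRestr (l a) (v a)).prod f = 0 := by
  refine Subtype.ext (funext fun y => ?_)
  obtain ⟨y', h1, -, h3⟩ := exists_hyperplaneRestr_prod hself hne (List.finRange n) y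
  rw [h3]
  exact hf y' fun a => h1 a (List.mem_finRange a)

end SmoothVec

/-! ### Local normal form of J at a regular zero -/

section Straightening

/-- A smooth map with surjective derivative at `x` is a projection in suitable coordinates. -/
theorem exists_straightening_vec {V W : Type*} [NormedAddCommGroup V] [NormedSpace ℝ V]
    [FiniteDimensional ℝ V] [NormedAddCommGroup W] [NormedSpace ℝ W] [FiniteDimensional ℝ W]
    {f : V → W} {U : Set V} (hU : IsOpen U) (hf : ContDiffOn ℝ ∞ f U) {x : V} (hx : x ∈ U)
    (hsurj : Function.Surjective (fderiv ℝ f x)) :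
    ∃ Ψ : OpenPartialHomeomorph V (W × (fderiv ℝ f x).ker), x ∈ Ψ.source ∧ Ψ.source ⊆ U ∧
      ContDiffOn ℝ ∞ Ψ Ψ.source ∧ ContDiffOn ℝ ∞ Ψ.symm Ψ.target ∧ ∀ y, (Ψ y).1 = f y := by
  obtain ⟨π₀, hπ₀⟩ := (fderiv ℝ f x).ker.subtype.exists_leftInverse_of_injective
    (Submodule.ker_subtype _)
  let π : V →L[ℝ] (fderiv ℝ f x).ker := LinearMap.toContinuousLinearMap π₀
  have hπ : ∀ k : (fderiv ℝ f x).ker, π k = k := LinearMap.congr_fun hπ₀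
  -- Completed by a projection onto the kernel of its derivative, f has an invertible derivative at
  -- x, and the inverse function theorem applies.
  let ψ : V → W × (fderiv ℝ f x).ker := fun y => (f y, π y)
  have hψ : ContDiffOn ℝ ∞ ψ U := hf.prodMk π.contDiff.contDiffOn
  have hψat : ∀ y ∈ U, ContDiffAt ℝ ∞ ψ y := fun y hy => hψ.contDiffAt (hU.mem_nhds hy)
  have hder : HasFDerivAt ψ ((fderiv ℝ f x).prod π) x :=
    ((hf.contDiffAt (hU.mem_nhds hx)).differentiableAt (by simp)).hasFDerivAt.prodMk
      π.hasFDerivAt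
  have hbij : Function.Bijective ((fderiv ℝ f x).prod π) := by
    constructor
    · rw [injective_iff_map_eq_zero]
      intro y hy
      have h1 : fderiv ℝ f x y = 0 := congrArg Prod.fst hy
      have h2 : π y = 0 := congrArg Prod.snd hy
      have h3 := hπ ⟨y, h1⟩
      rw [h2] at h3
      exact congrArg Subtype.val h3.symm
    · rintro ⟨w, k⟩
      obtain ⟨u, hu⟩ := hsurj w
      have hker : fderiv ℝ f x ((k - π u : (fderiv ℝ f x).ker) : V) = 0 :=
        (k - π u : (fderiv ℝ f x).ker).2
      refine ⟨u + (k - π u : (fderiv ℝ f x).ker), Prod.ext ?_ ?_⟩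
      · change fderiv ℝ f x (u + (k - π u : (fderiv ℝ f x).ker)) = w
        rw [map_add, hker, hu, add_zero]
      · change π (u + (k - π u : (fderiv ℝ f x).ker)) = k
        rw [map_add, hπ, add_sub_cancel]
  let ε : V ≃L[ℝ] (W × (fderiv ℝ f x).ker) :=
    (LinearEquiv.ofBijective ((fderiv ℝ f x).prod π).toLinearMap hbij).toContinuousLinearEquiv
  have hε : HasFDerivAt ψ (ε : V →L[ℝ] W × (fderiv ℝ f x).ker) x := by
    convert hder using 1
    ext1 y
    rfl
  let Ψ₀ := (hψat x hx).toOpenPartialHomeomorph ψ hε (by simp)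
  have hΨ₀ : ∀ y, Ψ₀ y = ψ y := fun _ => rfl
  -- Restricting to the open set where the derivative is invertible makes the inverse smooth on the
  -- whole target, not only at the image of x.
  let S : Set V := U ∩ fderiv ℝ ψ ⁻¹' Set.range ((↑) : (V ≃L[ℝ] W × (fderiv ℝ f x).ker) →
    V →L[ℝ] W × (fderiv ℝ f x).ker)
  have hS : IsOpen S := (hψ.continuousOn_fderiv_of_isOpen hU (by simp)).isOpen_inter_preimage hU
    ContinuousLinearEquiv.isOpen
  have hxS : x ∈ S := ⟨hx, ε, hε.fderiv.symm⟩
  have hsource : (Ψ₀.restrOpen S hS).source = Ψ₀.source ∩ S := rfl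
  refine ⟨Ψ₀.restrOpen S hS, ⟨(hψat x hx).mem_toOpenPartialHomeomorph_source hε (by simp), hxS⟩,
    ?_, ?_, ?_, fun _ => rfl⟩
  · rw [hsource]
    exact fun y hy => hy.2.1
  · exact hψ.mono fun y hy => hy.2.1
  · intro z hz
    have hz' : (Ψ₀.restrOpen S hS).symm z ∈ Ψ₀.source ∩ S :=
      (Ψ₀.restrOpen S hS).map_target hz
    obtain ⟨-, hzU, ε', hε'⟩ := hz'
    have hat := hψat _ hzU
    refine ((Ψ₀.restrOpen S hS).contDiffAt_symm (f₀' := ε') hz ?_ hat).contDiffWithinAt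
    rw [hε']
    exact (hat.differentiableAt (by simp)).hasFDerivAt

variable {m : ℕ} {M : Type*} [TopologicalSpace M] [ChartedSpace (EuclideanSpace ℝ (Fin m)) M]
  {g : Type*} [LieRing g] [LieAlgebra ℝ g] {n : ℕ} (e : Module.Basis (Fin n) ℝ g)

/-- The manifold derivative is by definition the derivative in the chart, taken within the range of
the model, which here is the whole space. -/
theorem fderiv_comp_chart_symm {f : M → ℝ} {x : M} (hf : MDifferentiableAt (𝓡 m) 𝓘(ℝ, ℝ) f x)
    (v : EuclideanSpace ℝ (Fin m)) :
    fderiv ℝ (fun y => f ((chartAt (EuclideanSpace ℝ (Fin m)) x).symm y))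
      (chartAt (EuclideanSpace ℝ (Fin m)) x x) v = mfderiv (𝓡 m) 𝓘(ℝ, ℝ) f x v := by
  have h : mfderiv (𝓡 m) 𝓘(ℝ, ℝ) f x = fderivWithin ℝ (writtenInExtChartAt (𝓡 m) 𝓘(ℝ, ℝ) x f)
    (Set.range (𝓡 m)) (extChartAt (𝓡 m) x x) := hf.mfderiv
  refine Eq.trans ?_ (congrArg (fun T : EuclideanSpace ℝ (Fin m) →L[ℝ] ℝ => T v) h.symm)
  simp only [writtenInExtChartAt, mfld_simps, fderivWithin_univ]
  rfl

variable [IsManifold (𝓡 m) ∞ M]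

/-- Near a point of a regular level set, the components of the map are coordinates. -/
theorem exists_straightening {J : M → Module.Dual ℝ g} (hJ : IsSmoothMap m J)
    (hreg : ZeroIsRegularValue m J) {x : M} (hx : J x = 0) :
    ∃ (E : Type) (_ : NormedAddCommGroup E) (_ : NormedSpace ℝ E) (_ : FiniteDimensional ℝ E)
      (l : Fin n → E →L[ℝ] ℝ) (v : Fin n → E) (Φ : OpenPartialHomeomorph M E),
      (∀ a, l a (v a) = 1) ∧ (∀ a b, a ≠ b → l b (v a) = 0) ∧ x ∈ Φ.source ∧
      ContMDiffOn (𝓡 m) 𝓘(ℝ, E) ∞ Φ Φ.source ∧ ContMDiffOn 𝓘(ℝ, E) (𝓡 m) ∞ Φ.symm Φ.target ∧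
      ∀ y ∈ Φ.source, ∀ a, l a (Φ y) = J y (e a) := by
  let φ := chartAt (EuclideanSpace ℝ (Fin m)) x
  have hφ : ContMDiffOn (𝓡 m) (𝓡 m) ∞ φ φ.source := contMDiffOn_chart
  have hφ' : ContMDiffOn (𝓡 m) (𝓡 m) ∞ φ.symm φ.target := contMDiffOn_chart_symm
  let f : EuclideanSpace ℝ (Fin m) → Fin n → ℝ := fun y a => J (φ.symm y) (e a)
  have hfa : ∀ ξ : g, ContDiffOn ℝ ∞ (fun y => J (φ.symm y) ξ) φ.target := fun ξ =>
    contMDiffOn_iff_contDiffOn.1 ((hJ ξ).comp_contMDiffOn hφ')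
  have hf : ContDiffOn ℝ ∞ f φ.target := contDiffOn_pi.2 fun a => hfa (e a)
  have hx0 : φ x ∈ φ.target := φ.map_source (mem_chart_source _ x)
  have hsurj : Function.Surjective (fderiv ℝ f (φ x)) := by
    intro w
    -- The functional prescribed here is the one taking the values w on the basis e.
    obtain ⟨v, hv⟩ := hreg x hx (e.constr ℝ w)
    refine ⟨v, funext fun a => ?_⟩
    have hd : ∀ a, DifferentiableAt ℝ (fun y => f y a) (φ x) := fun a =>
      ((hfa (e a)).contDiffAt (φ.open_target.mem_nhds hx0)).differentiableAt (by simp)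
    have h1 : fderiv ℝ f (φ x) v a = fderiv ℝ (fun y => f y a) (φ x) v := by
      rw [show f = fun y a => f y a from rfl, fderiv_pi hd]
      rfl
    rw [h1]
    refine (fderiv_comp_chart_symm (((hJ (e a)).mdifferentiable (by simp)) x) v).trans ?_
    rw [hv (e a)]
    exact e.constr_basis ℝ w a
  obtain ⟨Ψ, hxΨ, hΨU, hΨ, hΨ', hΨf⟩ := exists_straightening_vec φ.open_target hf hx0 hsurj
  refine ⟨(Fin n → ℝ) × (fderiv ℝ f (φ x)).ker, inferInstance, inferInstance, inferInstance,
    fun a => (ContinuousLinearMap.proj a).comp (ContinuousLinearMap.fst ℝ _ _),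
    fun a => (Pi.single a 1, 0), φ.trans Ψ, ?_, ?_, ?_, ?_, ?_, ?_⟩
  · intro a
    simp
  · intro a b hab
    simp [Pi.single_eq_of_ne hab.symm]
  · rw [OpenPartialHomeomorph.trans_source]
    exact ⟨mem_chart_source _ x, hxΨ⟩
  · rw [OpenPartialHomeomorph.trans_source]
    exact (contMDiffOn_iff_contDiffOn.2 hΨ).comp (hφ.mono Set.inter_subset_left) fun y hy => hy.2
  · rw [OpenPartialHomeomorph.trans_target]
    exact hφ'.comp ((contMDiffOn_iff_contDiffOn.2 hΨ').mono Set.inter_subset_left) fun y hy => hy.2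
  · intro y hy a
    rw [OpenPartialHomeomorph.trans_source] at hy
    have h1 : ((φ.trans Ψ) y).1 = f (φ y) := hΨf (φ y)
    change ((φ.trans Ψ) y).1 a = J y (e a)
    rw [h1]
    simp only [f]
    rw [φ.left_inv hy.1]

end Straightening

/-! ### Gluing with partitions of unity -/

section Patching

variable {m : ℕ} {M : Type*} [TopologicalSpace M] [ChartedSpace (EuclideanSpace ℝ (Fin m)) M]

theorem contMDiff_smoothFun (f : smoothFun m M) : ContMDiff (𝓡 m) 𝓘(ℝ, ℂ) ∞ f.1 := f.2

/-- The smooth function with underlying function `f`. -/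
def smoothFun.mk (f : M → ℂ) (hf : ContMDiff (𝓡 m) 𝓘(ℝ, ℂ) ∞ f) : smoothFun m M := ⟨f, hf⟩

theorem contMDiffOn_div {f h : M → ℂ} (hf : ContMDiff (𝓡 m) 𝓘(ℝ, ℂ) ∞ f)
    (hh : ContMDiff (𝓡 m) 𝓘(ℝ, ℂ) ∞ h) :
    ContMDiffOn (𝓡 m) 𝓘(ℝ, ℂ) ∞ (fun y => f y * (h y)⁻¹) {y | h y ≠ 0} := by
  intro y hy
  have hinv : ContMDiffAt (𝓡 m) 𝓘(ℝ, ℂ) ∞ (fun y => (h y)⁻¹) y :=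
    (contDiffAt_inv ℝ hy).contMDiffAt.comp y hh.contMDiffAt
  have hmul : ContDiff ℝ ∞ (fun p : ℂ × ℂ => p.1 * p.2) := contDiff_mul
  exact (hmul.contMDiff.contMDiffAt.comp y (hf.contMDiffAt.prodMk_space hinv)).contMDiffWithinAt

variable [T2Space M] [SigmaCompactSpace M] [IsManifold (𝓡 m) ∞ M]

/-- Solvability of a linear equation between free modules over the smooth functions is local. -/
theorem exists_preimage_of_local {N N' ι κ : Type*} [Finite ι] [AddCommGroup N]
    [Module (smoothFun m M) N] [AddCommGroup N'] [Module (smoothFun m M) N']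
    (b : Module.Basis ι (smoothFun m M) N) (c : Module.Basis κ (smoothFun m M) N')
    (T : N →ₗ[smoothFun m M] N') (z : N')
    (h : ∀ x : M, ∃ f : smoothFun m M, f.1 x ≠ 0 ∧ ∃ w, T w = f • z) : ∃ w, T w = z := by
  have := Fintype.ofFinite ι
  choose f hf w hw using h
  let U : M → Set M := fun x => {y | (f x).1 y ≠ 0}
  have hUo : ∀ x, IsOpen (U x) := fun x =>
    isOpen_ne_fun (contMDiff_smoothFun (f x)).continuous continuous_const
  obtain ⟨ρ, hρ⟩ := SmoothPartitionOfUnity.exists_isSubordinate (𝓡 m) isClosed_univ U hUo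
    fun x _ => Set.mem_iUnion.2 ⟨x, hf x⟩
  -- Coordinates of the local solution `w x / f x`, meaningful where `f x` is nonzero; the partition
  -- of unity is subordinate to these sets.
  let u : ι → M → M → ℂ := fun j x y => (b.repr (w x) j).1 y * ((f x).1 y)⁻¹
  let G : ι → smoothFun m M := fun j => smoothFun.mk (fun y => ∑ᶠ x, ρ x y • u j x y)
    (hρ.contMDiff_finsum_smul hUo fun x =>
      contMDiffOn_div (contMDiff_smoothFun (b.repr (w x) j)) (contMDiff_smoothFun (f x)))
  -- Linearity over the smooth functions makes T a matrix acting pointwise, so the glued solution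
  -- can be checked at each y, where the partition is a finite sum.
  have hcoord : ∀ (v : N) (k : κ) (y : M), (c.repr (T v) k).1 y
      = ∑ j, (b.repr v j).1 y * (c.repr (T (b j)) k).1 y := by
    intro v k y
    conv_lhs => rw [← b.sum_repr v]
    simp only [map_sum, map_smul, Finsupp.coe_finsetSum, Finset.sum_apply, Finsupp.smul_apply,
      AddSubmonoidClass.coe_finsetSum]
    rfl
  refine ⟨∑ j, G j • b j, c.repr.injective (Finsupp.ext fun k => Subtype.ext (funext fun y => ?_))⟩
  rw [hcoord]
  have hG : ∀ j, (b.repr (∑ j, G j • b j) j).1 y = ∑ x ∈ ρ.finsupport y, ρ x y • u j x y := by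
    intro j
    rw [b.repr_sum_self]
    exact (ρ.sum_finsupport_smul_eq_finsum y (u j)).symm
  simp only [hG, Finset.sum_mul]
  rw [Finset.sum_comm]
  have hterm : ∀ x ∈ ρ.finsupport y,
      ∑ j, (ρ x y • u j x y) * (c.repr (T (b j)) k).1 y = ρ x y • (c.repr z k).1 y := by
    intro x hx
    have hxy : (f x).1 y ≠ 0 := hρ x (subset_tsupport _ ((ρ.mem_finsupport y).1 hx))
    have h1 := hcoord (w x) k y
    rw [hw, map_smul] at h1
    have h2 : (f x).1 y * (c.repr z k).1 y
        = ∑ j, (b.repr (w x) j).1 y * (c.repr (T (b j)) k).1 y := h1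
    have h3 : (c.repr z k).1 y
        = ((f x).1 y)⁻¹ * ∑ j, (b.repr (w x) j).1 y * (c.repr (T (b j)) k).1 y := by
      rw [← h2, inv_mul_cancel_left₀ hxy]
    rw [h3, Finset.mul_sum, Finset.smul_sum]
    refine Finset.sum_congr rfl fun j _ => ?_
    simp only [u, smul_mul_assoc]
    congr 1
    ring
  rw [Finset.sum_congr rfl hterm, ← Finset.sum_smul, ρ.sum_finsupport y (Set.mem_univ y), one_smul]

/-- A smooth function on a closed subset is the restriction of a smooth function. -/
theorem restrict_surjective {C : Set M} (hC : IsClosed C) :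
    Function.Surjective (restrict m C) := by
  intro φ
  have hloc : ∀ x : M, ∃ U : Set M, IsOpen U ∧ x ∈ U ∧ ∃ F : M → ℂ,
      ContMDiffOn (𝓡 m) 𝓘(ℝ, ℂ) ∞ F U ∧ ∀ y : C, (y : M) ∈ U → φ.1 y = F y := by
    intro x
    by_cases hx : x ∈ C
    · exact φ.2 ⟨x, hx⟩
    -- Off the closed set there is no condition, so zero is a local extension.
    · exact ⟨Cᶜ, hC.isOpen_compl, hx, fun _ => 0, contMDiffOn_const, fun y hy => (hy y.2).elim⟩
  choose U hUo hxU F hF hφ using hloc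
  obtain ⟨ρ, hρ⟩ := SmoothPartitionOfUnity.exists_isSubordinate (𝓡 m) isClosed_univ U hUo
    fun x _ => Set.mem_iUnion.2 ⟨x, hxU x⟩
  refine ⟨smoothFun.mk (fun y => ∑ᶠ x, ρ x y • F x y) (hρ.contMDiff_finsum_smul hUo hF),
    Subtype.ext (funext fun y => ?_)⟩
  change ∑ᶠ x, ρ x y • F x y = φ.1 y
  rw [← ρ.sum_finsupport_smul_eq_finsum (y : M) F]
  have hterm : ∀ x ∈ ρ.finsupport (y : M), ρ x y • F x y = ρ x y • φ.1 y := fun x hx => by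
    rw [hφ x y (hρ x (subset_tsupport _ ((ρ.mem_finsupport (y : M)).1 hx)))]
  rw [Finset.sum_congr rfl hterm, ← Finset.sum_smul, ρ.sum_finsupport (y : M) (Set.mem_univ _),
    one_smul]

end Patching

/-! ### Transport of functions through a chart by cutoffs -/

section Cutoff

variable {m : ℕ} {M : Type*} [TopologicalSpace M] [ChartedSpace (EuclideanSpace ℝ (Fin m)) M]
  {E : Type*} [NormedAddCommGroup E] [NormedSpace ℝ E] {Φ : OpenPartialHomeomorph M E}

/-- Push-forward of functions along a chart, cut off to be defined everywhere. -/
def cutoffPush (hΦ : ContMDiffOn 𝓘(ℝ, E) (𝓡 m) ∞ Φ.symm Φ.target) {χ : E → ℝ}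
    (hχ : ContDiff ℝ ∞ χ) (hsupp : tsupport χ ⊆ Φ.target) : smoothFun m M →ₗ[ℂ] smoothVec E where
  toFun f := smoothVec.mk (fun y => χ y • f.1 (Φ.symm y)) (by
    rw [← contMDiff_iff_contDiff]
    refine contMDiff_of_tsupport fun y hy => ?_
    have hy' : y ∈ Φ.target := hsupp (tsupport_smul_subset_left _ _ hy)
    exact (hχ.contMDiff y).smul ((contMDiff_smoothFun f).contMDiffAt.comp y
      (hΦ.contMDiffAt (Φ.open_target.mem_nhds hy'))))
  map_add' f f' := Subtype.ext (funext fun y => smul_add _ _ _)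
  map_smul' z f := Subtype.ext (funext fun y => by
    change χ y • (z * f.1 (Φ.symm y)) = z * (χ y • f.1 (Φ.symm y))
    rw [mul_smul_comm])

/-- Pull-back of functions along a chart, cut off to be defined everywhere. -/
def cutoffPull (hΦ : ContMDiffOn (𝓡 m) 𝓘(ℝ, E) ∞ Φ Φ.source) {ρ : M → ℝ}
    (hρ : ContMDiff (𝓡 m) 𝓘(ℝ, ℝ) ∞ ρ) (hsupp : tsupport ρ ⊆ Φ.source) :
    smoothVec E →ₗ[ℂ] smoothFun m M where
  toFun f := smoothFun.mk (fun y => ρ y • f.1 (Φ y)) (by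
    refine contMDiff_of_tsupport fun y hy => ?_
    have hy' : y ∈ Φ.source := hsupp (tsupport_smul_subset_left _ _ hy)
    exact (hρ y).smul ((contDiff_smoothVec f).contMDiff.contMDiffAt.comp y
      (hΦ.contMDiffAt (Φ.open_source.mem_nhds hy'))))
  map_add' f f' := Subtype.ext (funext fun y => smul_add _ _ _)
  map_smul' z f := Subtype.ext (funext fun y => by
    change ρ y • (z * f.1 (Φ y)) = z * (ρ y • f.1 (Φ y))
    rw [mul_smul_comm])

end Cutoff

/-! ### Local exactness of the classical Koszul complex -/

section LocalExactness

variable {m : ℕ} {M : Type*} [TopologicalSpace M] [ChartedSpace (EuclideanSpace ℝ (Fin m)) M]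
  {g : Type*} [LieRing g] [LieAlgebra ℝ g] {n : ℕ} (e : Module.Basis (Fin n) ℝ g)
  {J : M → Module.Dual ℝ g} (hJ : IsSmoothMap m J)

theorem koszul_eq_koszulOp (i : ℕ) :
    koszul e J hJ i = koszulOp e (fun a => LinearMap.mulLeft ℂ (pairing J hJ (e a))) i := rfl

theorem smul_eq_tmap {V : Type*} [AddCommGroup V] [Module ℝ V] (f : smoothFun m M)
    (z : smoothFun m M ⊗[ℝ] V) :
    tmap (LinearMap.mulLeft ℂ f) LinearMap.id z = f • z := by
  induction z using TensorProduct.induction_on with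
  | zero => rw [map_zero, smul_zero]
  | tmul a v => rfl
  | add x y hx hy => rw [map_add, smul_add, hx, hy]

theorem koszul_smul (f : smoothFun m M) (i : ℕ) (z : KoszulSpace m M g (i + 1)) :
    koszul e J hJ i (f • z) = f • koszul e J hJ i z := by
  rw [← smul_eq_tmap, ← smul_eq_tmap, koszul_eq_koszulOp]
  exact (LinearMap.congr_fun (koszulOp_natural e (LinearMap.mulLeft ℂ f)
    (fun a => LinearMap.ext fun F => mul_left_comm _ _ _) i) z).symm

/-- The classical Koszul operator as a linear map over the smooth functions. -/
def koszulSmooth (i : ℕ) :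
    KoszulSpace m M g (i + 1) →ₗ[smoothFun m M] KoszulSpace m M g i where
  toFun := koszul e J hJ i
  map_add' := map_add _
  map_smul' f z := koszul_smul e hJ f i z

/-- Exterior multiplication by `e a` is a homotopy from multiplication by J_a to zero. This settles
exactness wherever J_a does not vanish. -/
theorem koszul_wedge (a : Fin n) (i : ℕ) (z : KoszulSpace m M g (i + 1))
    (hz : koszul e J hJ i z = 0) :
    koszul e J hJ (i + 1) (tmap LinearMap.id (wedge (e a) (i + 1)) z)
      = pairing J hJ (e a) • z := by
  have h : koszul e J hJ (i + 1) ∘ₗ tmap LinearMap.id (wedge (e a) (i + 1))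
      + tmap LinearMap.id (wedge (e a) i) ∘ₗ koszul e J hJ i
      = tmap (LinearMap.mulLeft ℂ (pairing J hJ (e a))) LinearMap.id := by
    simp only [koszul_eq_koszulOp, koszulOp, sum_linearMap_comp, linearMap_comp_sum,
      tmap_comp_tmap, LinearMap.comp_id, LinearMap.id_comp]
    rw [← Finset.sum_add_distrib, Finset.sum_eq_single a]
    · rw [← tmap_add_right, insertion_wedge]
      simp
    · intro b _ hb
      rw [← tmap_add_right, insertion_wedge]
      simp [Finsupp.single_eq_of_ne hb, tmap_zero_right]
    · simp
  have h := LinearMap.congr_fun h z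
  rwa [LinearMap.add_apply, LinearMap.comp_apply, LinearMap.comp_apply, hz, map_zero, add_zero,
    smul_eq_tmap] at h

theorem koszul_wedge_zero (a : Fin n) (z : KoszulSpace m M g 0) :
    koszul e J hJ 0 (tmap LinearMap.id (wedge (e a) 0) z) = pairing J hJ (e a) • z := by
  have h : koszul e J hJ 0 ∘ₗ tmap LinearMap.id (wedge (e a) 0)
      = tmap (LinearMap.mulLeft ℂ (pairing J hJ (e a))) LinearMap.id := by
    simp only [koszul_eq_koszulOp, koszulOp, sum_linearMap_comp, tmap_comp_tmap, LinearMap.comp_id,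
      insertion_wedge_zero]
    rw [Finset.sum_eq_single a]
    · simp
    · intro b _ hb
      simp [Finsupp.single_eq_of_ne hb, tmap_zero_right]
    · simp
  have h := LinearMap.congr_fun h z
  rwa [LinearMap.comp_apply, smul_eq_tmap] at h

theorem degZero_tmap {F : Type*} [NormedAddCommGroup F] [NormedSpace ℝ F]
    (T : smoothFun m M →ₗ[ℂ] smoothVec F) (z : KoszulSpace m M g 0)
    (hz : T (degZero m M g z) = 0) : tmap T LinearMap.id z = 0 := by
  obtain ⟨f, rfl⟩ := (degZero m M g).symm.surjective z
  rw [LinearEquiv.apply_symm_apply] at hz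
  have h1 : (degZero m M g).symm f = f ⊗ₜ (exteriorPower.zeroEquiv ℝ g).symm 1 := rfl
  rw [h1, TensorProduct.AlgebraTensorModule.map_tmul, hz, TensorProduct.zero_tmul]

variable [T2Space M] [IsManifold (𝓡 m) ∞ M]

/-- Near a zero of J, cut-off push-forward and pull-back are globally defined chain maps to and from
the Koszul complex of linear coordinates, whose composite is multiplication by a function nonzero at
x. Primitives found in the linear model thus return as primitives of a multiple of z. -/
theorem exists_local_exact (hreg : ZeroIsRegularValue m J) (x : M) :
    ∃ f : smoothFun m M, f.1 x ≠ 0 ∧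
      (∀ i (z : KoszulSpace m M g (i + 1)), koszul e J hJ i z = 0 →
        ∃ w, koszul e J hJ (i + 1) w = f • z) ∧
      ∀ z : KoszulSpace m M g 0, (∀ y, J y = 0 → (degZero m M g z).1 y = 0) →
        ∃ w, koszul e J hJ 0 w = f • z := by
  by_cases hx : J x = 0
  · obtain ⟨E, _, _, _, l, v, Φ, hself, hne, hxs, hΦ, hΦ', hl⟩ :=
      exists_straightening e hJ hreg hx
    obtain ⟨χ, hχs, -, hχ, -, hχx⟩ := exists_contDiff_tsupport_subset (n := ⊤)
      (Φ.open_target.mem_nhds (Φ.map_source hxs))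
    obtain ⟨ρ, -, hρs⟩ := (SmoothBumpFunction.nhds_basis_tsupport (I := 𝓡 m) x).mem_iff.1
      (Φ.open_source.mem_nhds hxs)
    have hχ0 : ∀ y, y ∉ Φ.target → χ y = 0 := fun y hy =>
      image_eq_zero_of_notMem_tsupport fun h => hy (hχs h)
    have hρ0 : ∀ y, y ∉ Φ.source → ρ y = 0 := fun y hy =>
      image_eq_zero_of_notMem_tsupport fun h => hy (hρs h)
    let ψ := cutoffPush hΦ' hχ hχs
    let θ := cutoffPull hΦ ρ.contMDiff hρs
    have hψ : ∀ a, ψ ∘ₗ LinearMap.mulLeft ℂ (pairing J hJ (e a))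
        = LinearMap.mulLeft ℂ (linearFun (l a)) ∘ₗ ψ := by
      refine fun a => LinearMap.ext fun F => Subtype.ext (funext fun y => ?_)
      change χ y • (((J (Φ.symm y) (e a) : ℝ) : ℂ) * F.1 (Φ.symm y))
        = ((l a y : ℝ) : ℂ) * (χ y • F.1 (Φ.symm y))
      by_cases hy : y ∈ Φ.target
      · rw [← hl _ (Φ.map_target hy), Φ.right_inv hy, mul_smul_comm]
      · simp [hχ0 y hy]
    have hθ : ∀ a, θ ∘ₗ LinearMap.mulLeft ℂ (linearFun (l a))
        = LinearMap.mulLeft ℂ (pairing J hJ (e a)) ∘ₗ θ := by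
      refine fun a => LinearMap.ext fun F => Subtype.ext (funext fun y => ?_)
      change ρ y • (((l a (Φ y) : ℝ) : ℂ) * F.1 (Φ y))
        = ((J y (e a) : ℝ) : ℂ) * (ρ y • F.1 (Φ y))
      by_cases hy : y ∈ Φ.source
      · rw [hl y hy, mul_smul_comm]
      · simp [hρ0 y hy]
    have hθψ : θ ∘ₗ ψ = LinearMap.mulLeft ℂ (θ (ψ 1)) := by
      refine LinearMap.ext fun F => Subtype.ext (funext fun y => ?_)
      change ρ y • χ (Φ y) • F.1 (Φ.symm (Φ y))
        = (ρ y • χ (Φ y) • (1 : ℂ)) * F.1 y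
      by_cases hy : y ∈ Φ.source
      · rw [Φ.left_inv hy]
        simp [mul_assoc]
      · simp [hρ0 y hy]
    have D := divisionOperators_hyperplane hself hne
    have htransfer : ∀ i (z : KoszulSpace m M g i) w,
        koszulOp e (fun a => LinearMap.mulLeft ℂ (linearFun (l a))) i w
          = tmap ψ LinearMap.id z → ∃ w, koszul e J hJ i w = θ (ψ 1) • z := by
      intro i z w hw
      refine ⟨tmap θ LinearMap.id w, ?_⟩
      have h1 := LinearMap.congr_fun (koszulOp_natural e θ hθ i) w
      rw [LinearMap.comp_apply, hw, ← LinearMap.comp_apply, tmap_comp_tmap, hθψ,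
        LinearMap.comp_id, smul_eq_tmap] at h1
      exact h1.symm
    refine ⟨θ (ψ 1), ?_, ?_, ?_⟩
    · change ρ x • χ (Φ x) • (1 : ℂ) ≠ 0
      rw [hχx, ρ.eq_one]
      simp
    · intro i z hz
      have h1 := LinearMap.congr_fun (koszulOp_natural e ψ hψ i) z
      rw [LinearMap.comp_apply, ← koszul_eq_koszulOp, hz, map_zero] at h1
      obtain ⟨w, hw⟩ := D.exact i _ h1.symm
      exact htransfer _ z w hw
    · intro z hz
      obtain ⟨w, hw⟩ := D.exists_zero (e := e) (List.finRange n) (tmap ψ LinearMap.id z)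
      refine htransfer 0 z w ?_
      have h1 : tmap ((List.finRange n).map fun a => hyperplaneRestr (l a) (v a)).prod
          LinearMap.id (tmap ψ LinearMap.id z) = 0 := by
        rw [← LinearMap.comp_apply, tmap_comp_tmap, LinearMap.comp_id]
        refine degZero_tmap _ z ?_
        -- The remainder only sees values on the common zero set of the coordinates, which
        -- corresponds to J = 0 inside the chart; outside, the cutoff vanishes.
        refine hyperplaneRestr_prod_eq_zero hself hne fun y hy => ?_
        change χ y • (degZero m M g z).1 (Φ.symm y) = 0
        by_cases hyt : y ∈ Φ.target
        · rw [hz, smul_zero]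
          refine e.ext fun a => ?_
          rw [← hl _ (Φ.map_target hyt), Φ.right_inv hyt, hy]
          rfl
        · rw [hχ0 y hyt, zero_smul]
      rwa [h1, add_zero] at hw
  · obtain ⟨a, ha⟩ : ∃ a, J x (e a) ≠ 0 := by
      by_contra! h
      exact hx (e.ext h)
    refine ⟨pairing J hJ (e a), Complex.ofReal_ne_zero.2 ha, ?_, ?_⟩
    · exact fun i z hz => ⟨_, koszul_wedge e hJ a i z hz⟩
    · exact fun z _ => ⟨_, koszul_wedge_zero e hJ a z⟩

end LocalExactness

/-! ### Global exactness and existence of classical homotopies -/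

section GlobalExactness

variable {m : ℕ} {M : Type*} [TopologicalSpace M] [ChartedSpace (EuclideanSpace ℝ (Fin m)) M]
  [T2Space M] [SigmaCompactSpace M] [IsManifold (𝓡 m) ∞ M]
  {g : Type*} [LieRing g] [LieAlgebra ℝ g] {n : ℕ} (e : Module.Basis (Fin n) ℝ g)
  {J : M → Module.Dual ℝ g} (hJ : IsSmoothMap m J)

/-- The exterior powers of g have finite bases, so the Koszul spaces are free of finite rank over
the smooth functions and local solutions can be glued. -/
theorem exists_koszul_eq_of_local (i : ℕ) (z : KoszulSpace m M g i)
    (h : ∀ x : M, ∃ f : smoothFun m M, f.1 x ≠ 0 ∧ ∃ w, koszul e J hJ i w = f • z) :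
    ∃ w, koszul e J hJ i w = z :=
  exists_preimage_of_local
    (Algebra.TensorProduct.basis (smoothFun m M) (e.exteriorPower (i + 1)))
    (Algebra.TensorProduct.basis (smoothFun m M) (e.exteriorPower i)) (koszulSmooth e hJ i) z h

theorem isClosed_zeroSet {m : ℕ} {M : Type*} [TopologicalSpace M]
    [ChartedSpace (EuclideanSpace ℝ (Fin m)) M] {g : Type*} [LieRing g] [LieAlgebra ℝ g] {n : ℕ}
    (e : Module.Basis (Fin n) ℝ g) {J : M → Module.Dual ℝ g} (hJ : IsSmoothMap m J) :
    IsClosed (zeroSet J) := by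
  have h : zeroSet J = ⋂ a, {x | J x (e a) = 0} := by
    ext x
    simp only [zeroSet, Set.mem_ofPred_eq, Set.mem_iInter]
    exact ⟨fun h a => by rw [h]; rfl, fun h => e.ext h⟩
  rw [h]
  exact isClosed_iInter fun a => isClosed_eq (hJ (e a)).continuous continuous_const

theorem restrict_comp_koszul {m : ℕ} {M : Type*} [TopologicalSpace M]
    [ChartedSpace (EuclideanSpace ℝ (Fin m)) M] {g : Type*} [LieRing g] [LieAlgebra ℝ g] {n : ℕ}
    (e : Module.Basis (Fin n) ℝ g) {J : M → Module.Dual ℝ g} (hJ : IsSmoothMap m J) :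
    (restrict m (zeroSet J) ∘ₗ (degZero m M g).toLinearMap) ∘ₗ koszul e J hJ 0 = 0 := by
  rw [koszul, linearMap_comp_sum]
  refine Finset.sum_eq_zero fun a _ => ?_
  refine TensorProduct.AlgebraTensorModule.ext fun f v => Subtype.ext (funext fun c => ?_)
  have hc : J (c : M) = 0 := c.2
  change (exteriorPower.zeroEquiv ℝ g (insertion (e.coord a) 0 v) : ℝ)
    • (((J c (e a) : ℝ) : ℂ) * f.1 c) = 0
  rw [hc, LinearMap.zero_apply, Complex.ofReal_zero, zero_mul, smul_zero]

theorem nonempty_classicalHomotopy (hreg : ZeroIsRegularValue m J) :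
    Nonempty (ClassicalHomotopy e J hJ) := by
  obtain ⟨p, h, h1, h2, h3, h4⟩ := exists_contracting_homotopy
    (restrict m (zeroSet J) ∘ₗ (degZero m M g).toLinearMap) (koszul e J hJ)
    ((restrict_surjective (isClosed_zeroSet e hJ)).comp (degZero m M g).surjective)
    (LinearMap.congr_fun (restrict_comp_koszul e hJ))
    (fun i => LinearMap.congr_fun (koszulOp_comp_koszulOp e
      (fun a b => LinearMap.ext fun F => mul_left_comm _ _ _) i))
    (fun z hz => exists_koszul_eq_of_local e hJ 0 z fun x => by
      obtain ⟨f, hfx, -, hf⟩ := exists_local_exact e hJ hreg x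
      exact ⟨f, hfx, hf z fun y hy => congrFun (congrArg Subtype.val hz) ⟨y, hy⟩⟩)
    (fun i z hz => exists_koszul_eq_of_local e hJ (i + 1) z fun x => by
      obtain ⟨f, hfx, hf, -⟩ := exists_local_exact e hJ hreg x
      exact ⟨f, hfx, hf i z hz⟩)
  exact ⟨{
    prol := (degZero m M g).toLinearMap ∘ₗ p
    h := h
    restrict_prol := LinearMap.ext h1
    homotopy_zero := LinearMap.ext fun x => by
      refine Eq.trans ?_ (h2 x)
      simp
    homotopy_succ := fun i => LinearMap.ext (h3 i)
    h_zero_prol := LinearMap.ext fun c => by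
      refine Eq.trans ?_ (h4 c)
      simp }⟩

end GlobalExactness

end QuantumKoszul

end

open QuantumKoszul in
theorem mainTheorem12 {m : ℕ} {M : Type*} [TopologicalSpace M] [T2Space M]
    [SecondCountableTopology M] [ChartedSpace (EuclideanSpace ℝ (Fin m)) M]
    [IsManifold (𝓡 m) ∞ M]
    {g : Type*} [LieRing g] [LieAlgebra ℝ g] {n : ℕ} (e : Module.Basis (Fin n) ℝ g)
    {P : PoissonStructure m M} {S : StarProduct P} (Q : QuantumMomentumMap S g)
    (hreg : ZeroIsRegularValue m (Q.J 0)) :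
    Nonempty (ClassicalHomotopy e (Q.J 0) (Q.smooth 0)) ∧
    ∀ H : ClassicalHomotopy e (Q.J 0) (Q.smooth 0),
      IsUnit (oneSubB1h0 Q H) ∧
      (∀ i, IsUnit (mixed Q H i)) ∧
      qHomotopy Q H 0 = cHomotopy Q H 0 ∘ₗ Ring.inverse (oneSubB1h0 Q H) ∧
      augBoundary Q H ∘ₗ augHomotopy Q H + augHomotopy Q H ∘ₗ augBoundary Q H
        = LinearMap.id ∧
      Function.Exact (augBoundary Q H) (augBoundary Q H) := by
  have := ChartedSpace.locallyCompactSpace (EuclideanSpace ℝ (Fin m)) M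
  -- Partitions of unity require σ-compactness; it follows from second countability since the charts
  -- make M locally compact.
  have : SigmaCompactSpace M := sigmaCompactSpace_of_locallyCompact_secondCountable
  exact ⟨nonempty_classicalHomotopy e (Q.smooth 0) hreg, fun H =>
    ⟨isUnit_oneSubB1h0 Q H, isUnit_mixed Q H, qHomotopy_zero Q H,
      augBoundary_comp_augHomotopy_add Q H, exact_augBoundary Q H⟩⟩
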